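/- Let $d\ge 0$ be an integer, $m\in\mathbb{R}$, and let $a\colon\mathbb{R}^d\times\mathbb{R}^d\to\mathbb{C}$ be a global elliptic symbol of order $m$: $a$ is smooth, for all $k,k'\in\mathbb{N}$ there is a constant $C_{k,k'}$ with $$\sup_{x\in\mathbb{R}^d}|D_x^kD_\xi^{k'}a(x,\xi)|\le C_{k,k'}(1+|\xi|)^{m-k'}\quad(\xi\in\mathbb{R}^d),$$ and there are $M\in\mathbb{R}$ and $C>0$ with $\inf_{x}|a(x,\xi)|\ge C|\xi|^m$ for $|\xi|>M$. Let $L_0$ be the operator in $L^2(\mathbb{R}^d)$ with domain the Schwartz space given by $$L_0u(x)=\int_{\mathbb{R}^d}e^{2\pi i\langle x,\xi\rangle}a(x,\xi)\hat u(\xi)\,d\xi,\qquad \hat u(\xi)=\int_{\mathbb{R}^d}e^{-2\pi i\langle x,\xi\rangle}u(x)\,dx,$$ let $L_0^*$ be its adjoint in $L^2(\mathbb{R}^d)$, and let $L=L_0^*L_0$ with domain $\{u\in D(L_0): L_0u\in D(L_0^*)\}$. Let $f\colon\mathbb{R}^d\to\mathbb{R}$ be smooth with compact support. For $v\in C_c^\infty(\mathbb{R}^d\times\mathbb{R},\mathbb{C})$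 put $\overline v(x,y)=v(x,y+f(x))$, let $L\overline v$ be the continuous function on $\mathbb{R}^d\times\mathbb{R}$ such that, for every $y$, $(L\overline v)(\cdot,y)$ represents $L(\overline v(\cdot,y))$, and define the Itô transform of $L$ by $(\hat Lv)(x,y)=(L\overline v)(x,y-f(x))$. Then $\hat Lv$ is well defined (exists and is unique) and belongs to $L^2(dx\otimes dy)$ for every $v\in C_c^\infty(\mathbb{R}^d\times\mathbb{R},\mathbb{C})$, and the operator $\hat L$ in $L^2(dx\otimes dy)$ with domain $C_c^\infty(\mathbb{R}^d\times\mathbb{R},\mathbb{C})$ is densely defined, symmetric and positive, i.e. $\langle \hat Lv,w\rangle=\langle v,\hat Lw\rangle$ and $\langle v,\hat Lv\rangle\ge0$. It has a positive self-adjoint extension, and for every positive self-adjoint extension $A$ of $\hat L$ there is a strongly continuous semigroup $(\hat P_t)_{t\ge0}$ of contractions on $L^2(dx\otimes dy)$ whose infinitesimal generator is $-A$. -/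

import Mathlib

open MeasureTheory Filter Topology
open scoped ContDiff SchwartzMap FourierTransform NNReal InnerProductSpace

noncomputable section

namespace ItoTransform

/-- The Euclidean space `ℝ^d`. -/
abbrev Sp (d : ℕ) : Type := EuclideanSpace ℝ (Fin d)

/-- The complex Hilbert space `L²(X)` of a measure space. -/
abbrev L2 (X : Type) [MeasureSpace X] : Type := Lp ℂ 2 (volume : Measure X)

/-! ### Symbols -/

/-- `a` is a global symbol of order `m`: it is smooth on `ℝ^d × ℝ^d` and for all `k`, `k'`
one has `|D_x^k D_ξ^{k'} a(x, ξ)| ≤ C_{k,k'} (1 + |ξ|)^{m - k'}`, uniformly in `x`. -/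
structure IsSymbol {d : ℕ} (m : ℝ) (a : Sp d → Sp d → ℂ) : Prop where
  smooth : ContDiff ℝ ∞ (fun p : Sp d × Sp d => a p.1 p.2)
  bound : ∀ k k' : ℕ, ∃ C : ℝ, ∀ x ξ : Sp d,
    ‖iteratedFDeriv ℝ k (fun z : Sp d => iteratedFDeriv ℝ k' (a z) ξ) x‖
      ≤ C * (1 + ‖ξ‖) ^ (m - (k' : ℝ))

/-- Ellipticity of order `m`: for `|ξ| > M` one has `|a(x, ξ)| ≥ C |ξ|^m`, uniformly in `x`. -/
def IsElliptic {d : ℕ} (m : ℝ) (a : Sp d → Sp d → ℂ) : Prop :=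
  ∃ M C : ℝ, 0 < C ∧ ∀ x ξ : Sp d, M < ‖ξ‖ → C * ‖ξ‖ ^ m ≤ ‖a x ξ‖

/-! ### The operators `L₀` and `L = L₀^* L₀` -/

/-- `(L₀ u)(x) = ∫ e^{2πi⟨x, ξ⟩} a(x, ξ) û(ξ) dξ`, where `û` is the Fourier transform of `u`. -/
def pdo {d : ℕ} (a : Sp d → Sp d → ℂ) (u : Sp d → ℂ) (x : Sp d) : ℂ :=
  ∫ ξ : Sp d, Complex.exp (2 * Real.pi * Complex.I * (⟪x, ξ⟫_ℝ : ℝ)) * (a x ξ * 𝓕 u ξ)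

section Aux

variable {d : ℕ} {m : ℝ} {a : Sp d → Sp d → ℂ}

theorem IsSymbol.smooth_right (ha : IsSymbol m a) (x : Sp d) : ContDiff ℝ ∞ (a x) :=
  ha.smooth.comp (contDiff_const.prodMk contDiff_id)

theorem IsSymbol.decay (ha : IsSymbol m a) (u : 𝓢(Sp d, ℂ)) (n k : ℕ) :
    ∃ C : ℝ, ∀ x ξ : Sp d,
      ‖ξ‖ ^ n * ‖iteratedFDeriv ℝ k (fun η => a x η * 𝓕 (u : Sp d → ℂ) η) ξ‖ ≤ C := by
  obtain ⟨N, hN⟩ := exists_nat_ge m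
  choose K hK using ha.bound 0
  have hK' : ∀ i x ξ, ‖iteratedFDeriv ℝ i (a x) ξ‖ ≤ |K i| * (1 + ‖ξ‖) ^ N := by
    intro i x ξ
    have h1 := hK i x ξ
    rw [norm_iteratedFDeriv_zero] at h1
    refine h1.trans ?_
    have h2 : (1 + ‖ξ‖) ^ (m - (i : ℝ)) ≤ (1 + ‖ξ‖) ^ N := by
      rw [← Real.rpow_natCast]
      apply Real.rpow_le_rpow_of_exponent_le (by linarith [norm_nonneg ξ])
      have : (0 : ℝ) ≤ i := Nat.cast_nonneg i
      linarith
    exact mul_le_mul (le_abs_self _) h2 (by positivity) (abs_nonneg _)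
  have hS : ∀ j, ∃ B : ℝ, ∀ ξ : Sp d,
      (1 + ‖ξ‖) ^ (n + N) * ‖iteratedFDeriv ℝ j (𝓕 (u : Sp d → ℂ)) ξ‖ ≤ B := by
    intro j
    refine ⟨2 ^ (n + N) * ((Finset.Iic (n + N, j)).sup
      (fun p => SchwartzMap.seminorm ℝ p.1 p.2)) (𝓕 u), fun ξ => ?_⟩
    have := SchwartzMap.one_add_le_sup_seminorm_apply (𝕜 := ℝ) (m := (n + N, j))
      (k := n + N) (n := j) le_rfl le_rfl (𝓕 u) ξ
    rw [SchwartzMap.fourier_coe] at this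
    exact this
  choose B hB using hS
  refine ⟨∑ i ∈ Finset.range (k + 1), (k.choose i : ℝ) * |K i| * B (k - i), fun x ξ => ?_⟩
  have hu : ContDiff ℝ ∞ (𝓕 (u : Sp d → ℂ)) := by
    rw [← SchwartzMap.fourier_coe]; exact (𝓕 u).smooth ⊤
  have h := norm_iteratedFDeriv_mul_le (ha.smooth_right x) hu ξ (n := k)
    (by exact_mod_cast le_top)
  refine (mul_le_mul_of_nonneg_left h (by positivity)).trans ?_
  rw [Finset.mul_sum]
  refine Finset.sum_le_sum fun i _ => ?_
  have hp : ‖ξ‖ ^ n ≤ (1 + ‖ξ‖) ^ n := by gcongr; linarith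
  calc ‖ξ‖ ^ n * ((k.choose i : ℝ) * ‖iteratedFDeriv ℝ i (a x) ξ‖
          * ‖iteratedFDeriv ℝ (k - i) (𝓕 (u : Sp d → ℂ)) ξ‖)
      ≤ (1 + ‖ξ‖) ^ n * ((k.choose i : ℝ) * (|K i| * (1 + ‖ξ‖) ^ N)
          * ‖iteratedFDeriv ℝ (k - i) (𝓕 (u : Sp d → ℂ)) ξ‖) := by
        gcongr; exact hK' i x ξ
    _ = (k.choose i : ℝ) * |K i| * ((1 + ‖ξ‖) ^ (n + N)
          * ‖iteratedFDeriv ℝ (k - i) (𝓕 (u : Sp d → ℂ)) ξ‖) := by ring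
    _ ≤ _ := by gcongr; exact hB _ ξ

theorem IsSymbol.contDiff_mul_fourier (ha : IsSymbol m a) (u : 𝓢(Sp d, ℂ)) (x : Sp d) :
    ContDiff ℝ ∞ (fun η => a x η * 𝓕 (u : Sp d → ℂ) η) := by
  have hu : ContDiff ℝ ∞ (𝓕 (u : Sp d → ℂ)) := by
    rw [← SchwartzMap.fourier_coe]; exact (𝓕 u).smooth ⊤
  exact (ha.smooth_right x).mul hu

theorem IsSymbol.integrable_aux (ha : IsSymbol m a) (u : 𝓢(Sp d, ℂ)) (n k : ℕ) :
    ∃ C : ℝ, ∀ x : Sp d,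
      Integrable (fun ξ => ‖ξ‖ ^ n *
        ‖iteratedFDeriv ℝ k (fun η => a x η * 𝓕 (u : Sp d → ℂ) η) ξ‖) ∧
      ∫ ξ, ‖ξ‖ ^ n * ‖iteratedFDeriv ℝ k (fun η => a x η * 𝓕 (u : Sp d → ℂ) η) ξ‖ ≤ C := by
  obtain ⟨C₁, h₁⟩ := ha.decay u 0 k
  obtain ⟨C₂, h₂⟩ := ha.decay u (n + (volume : Measure (Sp d)).integrablePower) k
  simp only [pow_zero, one_mul] at h₁
  refine ⟨2 ^ (volume : Measure (Sp d)).integrablePower *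
    (∫ x : Sp d, (1 + ‖x‖) ^ (-((volume : Measure (Sp d)).integrablePower : ℝ))) * (C₁ + C₂),
    fun x => ⟨?_, integral_pow_mul_le_of_le_of_pow_mul_le (h₁ x) (h₂ x)⟩⟩
  · exact integrable_of_le_of_pow_mul_le (h₁ x) (h₂ x)
      (((ha.contDiff_mul_fourier u x).continuous_iteratedFDeriv
        (by exact_mod_cast le_top)).aestronglyMeasurable)

theorem pdo_eq_fourierInv (u : Sp d → ℂ) (x : Sp d) :
    pdo a u x = 𝓕⁻ (fun ξ => a x ξ * 𝓕 u ξ) x := by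
  rw [Real.fourierInv_eq']
  unfold pdo
  congr 1
  ext ξ
  rw [smul_eq_mul, real_inner_comm]
  congr 2
  push_cast
  ring

theorem IsSymbol.integrable_pdo (ha : IsSymbol m a) (u : 𝓢(Sp d, ℂ)) (x : Sp d) :
    Integrable (fun ξ : Sp d =>
      Complex.exp (2 * Real.pi * Complex.I * (⟪x, ξ⟫_ℝ : ℝ)) * (a x ξ * 𝓕 (u : Sp d → ℂ) ξ)) := by
  obtain ⟨C, hC⟩ := ha.integrable_aux u 0 0
  have h := (hC x).1
  simp only [pow_zero, one_mul, norm_iteratedFDeriv_zero] at h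
  have hc := (ha.contDiff_mul_fourier u x).continuous
  refine h.mono' (Continuous.aestronglyMeasurable ?_) (ae_of_all _ fun ξ => ?_)
  · exact (by fun_prop : Continuous fun ξ : Sp d =>
      Complex.exp (2 * Real.pi * Complex.I * (⟪x, ξ⟫_ℝ : ℝ))).mul hc
  · rw [norm_mul, Complex.norm_exp]
    simp

/-- `L₀ u` is square integrable for every Schwartz function `u`. -/
theorem IsSymbol.memLp_pdo (ha : IsSymbol m a) (u : 𝓢(Sp d, ℂ)) :
    MemLp (pdo a u) 2 (volume : Measure (Sp d)) := by
  have hmeas : AEStronglyMeasurable (pdo a u) (volume : Measure (Sp d)) := by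
    have hu : Continuous (𝓕 (u : Sp d → ℂ)) := by
      rw [← SchwartzMap.fourier_coe]; exact (𝓕 u).continuous
    have hc : Continuous (fun p : Sp d × Sp d =>
        Complex.exp (2 * Real.pi * Complex.I * (⟪p.1, p.2⟫_ℝ : ℝ))
          * (a p.1 p.2 * 𝓕 (u : Sp d → ℂ) p.2)) := by
      have h1 := ha.smooth.continuous
      fun_prop
    exact hc.stronglyMeasurable.integral_prod_right.aestronglyMeasurable
  have hdec : ∀ n : ℕ, ∃ C : ℝ, ∀ x : Sp d, ‖x‖ ^ n * ‖pdo a u x‖ ≤ C := by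
    intro n
    choose C hC using fun i j => ha.integrable_aux u i j
    refine ⟨(2 * Real.pi) ^ 0 * (2 * (0 : ℕ) + 2) ^ n * ∑ p ∈ Finset.range (0 + 1) ×ˢ
      Finset.range (n + 1), C p.1 p.2, fun x => ?_⟩
    have h := Real.pow_mul_norm_iteratedFDeriv_fourier_le (K := ⊤) (N := ⊤)
      (ha.contDiff_mul_fourier u x) (fun i j _ _ => (hC i j x).1) (k := 0) (n := n)
      le_top le_top (-x)
    rw [norm_iteratedFDeriv_zero, norm_neg, ← Real.fourierInv_eq_fourier_neg,
      ← pdo_eq_fourierInv] at h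
    refine h.trans ?_
    refine mul_le_mul_of_nonneg_left (Finset.sum_le_sum fun p _ => (hC p.1 p.2 x).2) ?_
    positivity
  obtain ⟨C₀, h₀⟩ := hdec 0
  obtain ⟨C₁, h₁⟩ := hdec (volume : Measure (Sp d)).integrablePower
  simp only [pow_zero, one_mul] at h₀
  have hint : Integrable (pdo a u) (volume : Measure (Sp d)) := by
    have := integrable_of_le_of_pow_mul_le (μ := (volume : Measure (Sp d))) (k := 0)
      h₀ (by simpa using h₁) hmeas
    simpa [integrable_norm_iff hmeas] using this
  rw [memLp_two_iff_integrable_sq_norm hmeas]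
  refine (hint.norm.const_mul C₀).mono' (hmeas.norm.pow 2) (ae_of_all _ fun x => ?_)
  rw [Real.norm_of_nonneg (by positivity), pow_two]
  exact mul_le_mul_of_nonneg_right (h₀ x) (norm_nonneg _)

end Aux

/-- The map `u ↦ L₀ u` from the Schwartz space to `L²(ℝ^d)`. -/
def pdoL2 {d : ℕ} {m : ℝ} {a : Sp d → Sp d → ℂ} (ha : IsSymbol m a) :
    𝓢(Sp d, ℂ) →ₗ[ℂ] L2 (Sp d) where
  toFun u := (ha.memLp_pdo u).toLp (pdo a u)
  map_add' u v := by
    rw [← MemLp.toLp_add]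
    congr 1
    ext x
    have h := integral_add (ha.integrable_pdo u x) (ha.integrable_pdo v x)
    rw [Pi.add_apply]
    refine Eq.trans ?_ h
    unfold pdo
    congr 1
    ext ξ
    simp only [← SchwartzMap.fourier_coe, FourierTransform.fourier_add, add_apply]
    ring
  map_smul' c u := by
    rw [RingHom.id_apply, ← MemLp.toLp_const_smul]
    congr 1
    ext x
    have h := integral_const_mul (μ := volume) c (fun ξ : Sp d =>
      Complex.exp (2 * Real.pi * Complex.I * (⟪x, ξ⟫_ℝ : ℝ)) * (a x ξ * 𝓕 (u : Sp d → ℂ) ξ))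
    rw [Pi.smul_apply, smul_eq_mul]
    refine Eq.trans ?_ h
    unfold pdo
    congr 1
    ext ξ
    simp only [← SchwartzMap.fourier_coe, FourierTransform.fourier_smul, smul_apply,
      smul_eq_mul]
    ring

/-- The embedding of the Schwartz space into `L²(ℝ^d)`. -/
def schwartzL2 (d : ℕ) : 𝓢(Sp d, ℂ) →ₗ[ℂ] L2 (Sp d) :=
  (SchwartzMap.toLpCLM ℂ ℂ 2 (volume : Measure (Sp d))).toLinearMap

theorem schwartzL2_injective (d : ℕ) : Function.Injective (schwartzL2 d) :=
  SchwartzMap.injective_toLp 2 (volume : Measure (Sp d))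

/-- `L₀` as an unbounded operator in `L²(ℝ^d)`, with domain the Schwartz space. -/
def opL0 {d : ℕ} {m : ℝ} {a : Sp d → Sp d → ℂ} (ha : IsSymbol m a) :
    L2 (Sp d) →ₗ.[ℂ] L2 (Sp d) where
  domain := LinearMap.range (schwartzL2 d)
  toFun := pdoL2 ha ∘ₗ
    (LinearEquiv.ofInjective (schwartzL2 d) (schwartzL2_injective d)).symm.toLinearMap

/-- `T^* T` with its natural domain `{u ∈ D(T) | T u ∈ D(T^*)}`. -/
def adjointMulSelf {H : Type*} [NormedAddCommGroup H] [InnerProductSpace ℂ H] [CompleteSpace H]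
    (T : H →ₗ.[ℂ] H) : H →ₗ.[ℂ] H :=
  T.adjoint.comp
    (T.domRestrict ((T.adjoint.domain.comap T.toFun).map T.domain.subtype)) (by
      rintro ⟨x, hx, hx'⟩
      obtain ⟨z, hz, rfl⟩ := hx
      exact hz)

/-- `L = L₀^* L₀`, where `L₀^*` is the adjoint of `L₀` in `L²(ℝ^d)`. -/
def opL {d : ℕ} {m : ℝ} {a : Sp d → Sp d → ℂ} (ha : IsSymbol m a) :
    L2 (Sp d) →ₗ.[ℂ] L2 (Sp d) :=
  adjointMulSelf (opL0 ha)

/-! ### The Itô transform -/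

/-- Smooth complex functions with compact support. -/
def IsTest {X : Type} [NormedAddCommGroup X] [NormedSpace ℝ X] (v : X → ℂ) : Prop :=
  ContDiff ℝ ∞ v ∧ HasCompactSupport v

/-- `w̄(x, y) = w(x, y + f(x))`. -/
def shear {d : ℕ} (f : Sp d → ℝ) (w : Sp d × ℝ → ℂ) : Sp d × ℝ → ℂ :=
  fun p => w (p.1, p.2 + f p.1)

/-- `G = T w` with `y` frozen: `G` is a continuous function on `ℝ^d × ℝ` and, for every `y`, the
function `w(·, y)` lies in the domain of `T` and is mapped by `T` to `G(·, y)`.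
(Continuity makes the values of `G` at every point meaningful and unique.) -/
def IsFrozenApply {d : ℕ} (T : L2 (Sp d) →ₗ.[ℂ] L2 (Sp d)) (w G : Sp d × ℝ → ℂ) : Prop :=
  Continuous G ∧ ∀ y : ℝ, ∃ u : T.domain,
    ((u : L2 (Sp d)) : Sp d → ℂ) =ᵐ[volume] (fun x => w (x, y)) ∧
    (T u : Sp d → ℂ) =ᵐ[volume] (fun x => G (x, y))

/-- `F = T̂ v`: one has `F(x, y) = (T v̄)(x, y - f(x))`, where `v̄(x, y) = v(x, y + f(x))` and `T` is
applied to `v̄` with `y` frozen. -/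
def IsItoTransform {d : ℕ} (T : L2 (Sp d) →ₗ.[ℂ] L2 (Sp d)) (f : Sp d → ℝ)
    (v F : Sp d × ℝ → ℂ) : Prop :=
  ∃ G : Sp d × ℝ → ℂ, IsFrozenApply T (shear f v) G ∧ ∀ x y, F (x, y) = G (x, y - f x)

theorem IsFrozenApply.add {d : ℕ} {T : L2 (Sp d) →ₗ.[ℂ] L2 (Sp d)} {w₁ w₂ G₁ G₂ : Sp d × ℝ → ℂ}
    (h₁ : IsFrozenApply T w₁ G₁) (h₂ : IsFrozenApply T w₂ G₂) :
    IsFrozenApply T (fun p => w₁ p + w₂ p) (fun p => G₁ p + G₂ p) := by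
  refine ⟨h₁.1.add h₂.1, fun y => ?_⟩
  obtain ⟨u₁, hu₁, hT₁⟩ := h₁.2 y
  obtain ⟨u₂, hu₂, hT₂⟩ := h₂.2 y
  refine ⟨u₁ + u₂, ?_, ?_⟩
  · rw [Submodule.coe_add]
    filter_upwards [Lp.coeFn_add (u₁ : L2 (Sp d)) u₂, hu₁, hu₂] with x h h1 h2
    rw [h, Pi.add_apply, h1, h2]
  · rw [T.map_add]
    filter_upwards [Lp.coeFn_add (T u₁) (T u₂), hT₁, hT₂] with x h h1 h2
    rw [h, Pi.add_apply, h1, h2]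

theorem IsFrozenApply.smul {d : ℕ} {T : L2 (Sp d) →ₗ.[ℂ] L2 (Sp d)} {w G : Sp d × ℝ → ℂ}
    (c : ℂ) (h₁ : IsFrozenApply T w G) :
    IsFrozenApply T (fun p => c * w p) (fun p => c * G p) := by
  refine ⟨continuous_const.mul h₁.1, fun y => ?_⟩
  obtain ⟨u₁, hu₁, hT₁⟩ := h₁.2 y
  refine ⟨c • u₁, ?_, ?_⟩
  · rw [Submodule.coe_smul]
    filter_upwards [Lp.coeFn_smul c (u₁ : L2 (Sp d)), hu₁] with x h h1
    rw [h, Pi.smul_apply, h1, smul_eq_mul]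
  · rw [T.map_smul]
    filter_upwards [Lp.coeFn_smul c (T u₁), hT₁] with x h h1
    rw [h, Pi.smul_apply, h1, smul_eq_mul]

/-- The graph in `L²(dx ⊗ dy)` of the Itô transform `v ↦ T̂ v` on smooth functions `v` with
compact support. -/
def itoGraph {d : ℕ} (T : L2 (Sp d) →ₗ.[ℂ] L2 (Sp d)) (f : Sp d → ℝ) :
    Submodule ℂ (L2 (Sp d × ℝ) × L2 (Sp d × ℝ)) where
  carrier := {p | ∃ v F : Sp d × ℝ → ℂ, IsTest v ∧ IsItoTransform T f v F ∧
    (p.1 : Sp d × ℝ → ℂ) =ᵐ[volume] v ∧ (p.2 : Sp d × ℝ → ℂ) =ᵐ[volume] F}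
  add_mem' := by
    rintro p q ⟨v, F, hv, ⟨G, hG, hF⟩, h1, h2⟩ ⟨v', F', hv', ⟨G', hG', hF'⟩, h1', h2'⟩
    refine ⟨fun z => v z + v' z, fun z => F z + F' z, ⟨hv.1.add hv'.1, hv.2.add hv'.2⟩,
      ⟨_, hG.add hG', fun x y => by simp only [hF, hF']⟩, ?_, ?_⟩
    · filter_upwards [Lp.coeFn_add p.1 q.1, h1, h1'] with z h e1 e2
      rw [Prod.fst_add, h, Pi.add_apply, e1, e2]
    · filter_upwards [Lp.coeFn_add p.2 q.2, h2, h2'] with z h e1 e2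
      rw [Prod.snd_add, h, Pi.add_apply, e1, e2]
  zero_mem' := by
    refine ⟨fun _ => 0, fun _ => 0, ⟨contDiff_const, HasCompactSupport.zero⟩,
      ⟨fun _ => 0, ⟨continuous_const, fun y => ⟨0, ?_, ?_⟩⟩, fun x y => rfl⟩, ?_, ?_⟩
    · exact Lp.coeFn_zero ℂ 2 (volume : Measure (Sp d))
    · rw [T.map_zero]; exact Lp.coeFn_zero ℂ 2 (volume : Measure (Sp d))
    · exact Lp.coeFn_zero ℂ 2 (volume : Measure (Sp d × ℝ))
    · exact Lp.coeFn_zero ℂ 2 (volume : Measure (Sp d × ℝ))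
  smul_mem' := by
    rintro c p ⟨v, F, hv, ⟨G, hG, hF⟩, h1, h2⟩
    refine ⟨fun z => c * v z, fun z => c * F z, ⟨contDiff_const.mul hv.1, hv.2.mul_left⟩,
      ⟨_, hG.smul c, fun x y => by simp only [hF]⟩, ?_, ?_⟩
    · filter_upwards [Lp.coeFn_smul c p.1, h1] with z h e1
      rw [Prod.smul_fst, h, Pi.smul_apply, e1, smul_eq_mul]
    · filter_upwards [Lp.coeFn_smul c p.2, h2] with z h e1
      rw [Prod.smul_snd, h, Pi.smul_apply, e1, smul_eq_mul]

/-- The Itô transform `L̂` of `L = L₀^* L₀`, as an unbounded operator in `L²(dx ⊗ dy)`. -/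
def itoL {d : ℕ} {m : ℝ} {a : Sp d → Sp d → ℂ} (ha : IsSymbol m a) (f : Sp d → ℝ) :
    L2 (Sp d × ℝ) →ₗ.[ℂ] L2 (Sp d × ℝ) :=
  (itoGraph (opL ha) f).toLinearPMap

/-! ### Unbounded operators and semigroups in a Hilbert space -/

section Hilbert

variable {H : Type*} [NormedAddCommGroup H] [InnerProductSpace ℂ H]

/-- `T` is symmetric: densely defined with `⟨T u, w⟩ = ⟨u, T w⟩` on its domain. -/
def IsSymm (T : H →ₗ.[ℂ] H) : Prop :=
  Dense (T.domain : Set H) ∧ ∀ u w : T.domain, inner ℂ (T u) (w : H) = inner ℂ (u : H) (T w)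

/-- `T` is positive: `⟨u, T u⟩` is real and nonnegative for all `u` in the domain. -/
def IsPos (T : H →ₗ.[ℂ] H) : Prop :=
  ∀ u : T.domain, (inner ℂ (u : H) (T u)).im = 0 ∧ 0 ≤ (inner ℂ (u : H) (T u)).re

/-- A strongly continuous semigroup of contractions `(P_t)_{t ≥ 0}`. -/
structure IsContractionSemigroup (P : ℝ≥0 → H →L[ℂ] H) : Prop where
  zero : P 0 = ContinuousLinearMap.id ℂ H
  add : ∀ s t, P (s + t) = (P s).comp (P t)
  contraction : ∀ t u, ‖P t u‖ ≤ ‖u‖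
  continuous : ∀ u, Continuous fun t => P t u

/-- `B` is the infinitesimal generator of `P`: `u ∈ D(B)` with `B u = w` if and only if
`(P_t u - u) / t → w` as `t → 0+`. -/
def IsGenerator (B : H →ₗ.[ℂ] H) (P : ℝ≥0 → H →L[ℂ] H) : Prop :=
  ∀ u w : H, (u, w) ∈ B.graph ↔
    Tendsto (fun t : ℝ≥0 => (((t : ℝ)⁻¹ : ℝ) : ℂ) • (P t u - u)) (𝓝[>] 0) (𝓝 w)

end Hilbert

end ItoTransform

end

/-! The shear `(x, y) ↦ (x, y + f x)` preserves Lebesgue measure, and it conjugates `L̂` to `L`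
acting in `x` with `y` frozen. Hence, on test functions, `⟨L̂ v, w⟩ = ∫ ⟨L₀ v̄(·, y), L₀ w̄(·, y)⟩
dy` (`integral_conj_itoFun_mul`). This form is Hermitian and nonnegative on the diagonal, which is
symmetry and positivity.

The analytic work is to show that `v̄(·, y)` lies in the domain of `L₀^* L₀`, with an image that is
jointly continuous and square integrable. The symbol estimates are turned into bounds on all joint
derivatives. Oscillatory integrals whose kernels decay rapidly in the integration variable are then
Schwartz functions, uniformly in a parameter (`RapidKernel.unifSchwartz_osc`). So `pdo a` and its
formal adjoint `adjPdo a` both preserve uniform families of Schwartz functions, and Fubini shows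
that `adjPdo a` is `L₀^*` on such functions (`IsSymbol.integral_conj_mul_pdo`).

The rest is Hilbert space theory. For the Friedrichs extension, let `K` be the canonical map into
`H` from the completion in the energy norm; then `S = K K^*` is injective and `S⁻¹ - 1` is the
extension. For a positive self-adjoint `A`, the resolvent `R = (1 + A)⁻¹` is a positive contraction
and `exp (-t A)` is a continuous function of `R` when `t > 0`. The bounded functional calculus
therefore suffices, and strong continuity and the generator come from scalar inequalities on `[0,
1]`. -/

noncomputable section

namespace ItoTransform

/-! ### Resolvents of positive self-adjoint operators -/

section SelfAdjoint

variable {H : Type*} [NormedAddCommGroup H] [InnerProductSpace ℂ H]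

theorem IsPos.re_inner_nonneg_of_mem_graph {A : H →ₗ.[ℂ] H} (hA : IsPos A) {u w : H}
    (h : (u, w) ∈ A.graph) : 0 ≤ (inner ℂ u w).re := by
  obtain ⟨y, rfl, rfl⟩ := (LinearPMap.mem_graph_iff A).1 h
  exact (hA y).2

/-- Expand `‖u + w‖²`: the cross term is nonnegative. This is the lower bound for `1 + A` on its
graph (with the sup norm), hence injectivity and closed range. -/
theorem IsPos.norm_le_norm_add {A : H →ₗ.[ℂ] H} (hA : IsPos A) {u w : H}
    (h : (u, w) ∈ A.graph) : ‖(u, w)‖ ≤ ‖u + w‖ := by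
  have h1 := @norm_add_sq ℂ H _ _ _ u w
  have h2 := hA.re_inner_nonneg_of_mem_graph h
  rw [RCLike.re_eq_complex_re] at h1
  refine max_le ?_ ?_
  · exact le_of_sq_le_sq (by nlinarith [sq_nonneg ‖w‖]) (norm_nonneg _)
  · exact le_of_sq_le_sq (by nlinarith [sq_nonneg ‖u‖]) (norm_nonneg _)

variable [CompleteSpace H]

theorem mem_graph_adjoint_iff {A : H →ₗ.[ℂ] H} (hA : Dense (A.domain : Set H)) (u w : H) :
    (u, w) ∈ A.adjoint.graph ↔ ∀ z : A.domain, inner ℂ w (z : H) = inner ℂ u (A z) := by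
  rw [LinearPMap.mem_graph_iff]
  constructor
  · rintro ⟨y, rfl, rfl⟩ z
    exact LinearPMap.adjoint_isFormalAdjoint hA y z
  · intro h
    exact ⟨⟨u, LinearPMap.mem_adjoint_domain_of_exists u ⟨w, h⟩⟩, rfl,
      LinearPMap.adjoint_apply_eq hA _ h⟩

/-- The resolvent `(1 + A)⁻¹` of a positive self-adjoint operator. -/
theorem exists_resolvent {A : H →ₗ.[ℂ] H} (hA : IsSelfAdjoint A) (hpos : IsPos A) :
    ∃ R : H →L[ℂ] H, (∀ u w, (u, w) ∈ A.graph ↔ R (u + w) = u) ∧ 0 ≤ R ∧ ‖R‖ ≤ 1 := by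
  have hcl : IsClosed (A.graph : Set (H × H)) := hA.isClosed
  have : CompleteSpace A.graph := hcl.completeSpace_coe
  let φ : A.graph →L[ℂ] H :=
    (ContinuousLinearMap.fst ℂ H H + ContinuousLinearMap.snd ℂ H H).comp A.graph.subtypeL
  have hφ : ∀ p : A.graph, ‖p‖ ≤ ‖φ p‖ := fun p => hpos.norm_le_norm_add p.2
  have hanti : AntilipschitzWith 1 φ := φ.antilipschitz_of_bound (by simpa using hφ)
  have hrange : LinearMap.range φ.toLinearMap = ⊤ := by
    have hc : IsClosed (LinearMap.range φ.toLinearMap : Set H) := by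
      rw [LinearMap.coe_range]
      exact hanti.isClosed_range φ.uniformContinuous
    have : (LinearMap.range φ.toLinearMap).HasOrthogonalProjection := by
      have := hc.completeSpace_coe
      infer_instance
    rw [← Submodule.orthogonal_eq_bot_iff, Submodule.eq_bot_iff]
    intro h hh
    rw [Submodule.mem_orthogonal'] at hh
    -- A vector `h` orthogonal to the range of `1 + A` satisfies `A^* h = -h`. As `A^* = A` is
    -- positive, `-‖h‖² ≥ 0`.
    have hmem : (h, -h) ∈ A.adjoint.graph := by
      rw [mem_graph_adjoint_iff hA.dense_domain]
      intro z
      have := hh _ ⟨⟨_, A.mem_graph z⟩, rfl⟩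
      have h2 : inner ℂ h ((z : H) + A z) = 0 := this
      rw [inner_add_right] at h2
      rw [inner_neg_left]
      linear_combination -h2
    rw [LinearPMap.isSelfAdjoint_def.1 hA] at hmem
    have := hpos.re_inner_nonneg_of_mem_graph hmem
    rw [inner_neg_right, Complex.neg_re, ← RCLike.re_eq_complex_re,
      inner_self_eq_norm_sq] at this
    have : ‖h‖ ^ 2 = 0 := le_antisymm (by linarith) (sq_nonneg _)
    simpa using this
  let e : A.graph ≃L[ℂ] H := ContinuousLinearEquiv.ofBijective φ
    (LinearMap.ker_eq_bot.2 hanti.injective) hrange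
  have he : ∀ p, e p = φ p := fun p => rfl
  let R : H →L[ℂ] H := (ContinuousLinearMap.fst ℂ H H).comp
    (A.graph.subtypeL.comp (e.symm : H →L[ℂ] A.graph))
  have hR : ∀ h, ∃ w, (R h, w) ∈ A.graph ∧ R h + w = h := by
    intro h
    refine ⟨(e.symm h : H × H).2, (e.symm h).2, ?_⟩
    have := he (e.symm h)
    rw [ContinuousLinearEquiv.apply_symm_apply] at this
    exact this.symm
  have hnorm : ‖R‖ ≤ 1 := by
    refine R.opNorm_le_bound zero_le_one fun h => ?_
    obtain ⟨w, hw, hh⟩ := hR h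
    have := hpos.norm_le_norm_add hw
    rw [hh] at this
    rw [one_mul]
    exact (le_max_left _ _).trans this
  refine ⟨R, fun u w => ⟨fun h => ?_, fun h => ?_⟩, ?_, hnorm⟩
  · have : e.symm (u + w) = ⟨(u, w), h⟩ := by
      rw [ContinuousLinearEquiv.symm_apply_eq]; rfl
    change (e.symm (u + w) : H × H).1 = u
    rw [this]
  · obtain ⟨w', hw', hh⟩ := hR (u + w)
    rw [h] at hh hw'
    rwa [add_left_cancel hh] at hw'
  · rw [ContinuousLinearMap.nonneg_iff_isPositive, ContinuousLinearMap.isPositive_iff_complex]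
    intro h
    obtain ⟨w, hw, hh⟩ := hR h
    obtain ⟨y, hy1, hy2⟩ := (LinearPMap.mem_graph_iff A).1 hw
    have h1 := hpos y
    rw [hy1, hy2] at h1
    dsimp only at h1
    -- With `h = R h + w` and `w = A (R h)`, the form of `R` is a square plus the form of `A`.
    have h3 : inner ℂ (R h) h = (‖R h‖ : ℂ) ^ 2 + inner ℂ (R h) w := by
      calc inner ℂ (R h) h = inner ℂ (R h) (R h + w) := by rw [hh]
        _ = _ := by rw [inner_add_right, inner_self_eq_norm_sq_to_K]; rfl
    rw [h3]
    have h4 : ((‖R h‖ : ℂ) ^ 2).im = 0 := by rw [← Complex.ofReal_pow, Complex.ofReal_im]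
    have h5 : ((‖R h‖ : ℂ) ^ 2).re = ‖R h‖ ^ 2 := by
      rw [← Complex.ofReal_pow, Complex.ofReal_re]
    constructor
    · apply Complex.ext
      · simp
      · simp [h4, h1.1]
    · simp only [map_add, RCLike.re_eq_complex_re, h5]
      nlinarith [h1.2, sq_nonneg ‖R h‖]

end SelfAdjoint

/-! ### Scalar estimates for the exponential in the resolvent variable -/

/-- `r ↦ exp (-t (1/r - 1))` for `r > 0`, extended by `0`. -/
def heatFun (t r : ℝ) : ℝ := if r ≤ 0 then 0 else Real.exp (-(t * (r⁻¹ - 1)))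

theorem heatFun_of_pos {t r : ℝ} (hr : 0 < r) :
    heatFun t r = Real.exp (-(t * (r⁻¹ - 1))) := if_neg hr.not_ge

theorem heatFun_zero (t : ℝ) : heatFun t 0 = 0 := if_pos le_rfl

theorem continuous_heatFun {t : ℝ} (ht : 0 < t) : Continuous (heatFun t) := by
  rw [continuous_iff_continuousAt]
  intro r
  rcases lt_trichotomy r 0 with h | rfl | h
  · have : heatFun t =ᶠ[𝓝 r] fun _ => 0 := by
      filter_upwards [gt_mem_nhds h] with x hx using if_pos hx.le
    exact continuousAt_const.congr this.symm
  · rw [continuousAt_iff_continuous_left'_right']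
    constructor
    · have : heatFun t =ᶠ[𝓝[<] 0] fun _ => 0 := by
        filter_upwards [self_mem_nhdsWithin] with x hx using if_pos (le_of_lt hx)
      rw [ContinuousWithinAt, heatFun_zero]
      exact tendsto_const_nhds.congr' this.symm
    · have : heatFun t =ᶠ[𝓝[>] 0] fun x => Real.exp (-(t * (x⁻¹ - 1))) := by
        filter_upwards [self_mem_nhdsWithin] with x hx using heatFun_of_pos hx
      rw [ContinuousWithinAt, heatFun_zero]
      refine Tendsto.congr' this.symm (Real.tendsto_exp_neg_atTop_nhds_zero.comp ?_)
      exact (tendsto_atTop_add_const_right _ (-1) tendsto_inv_nhdsGT_zero).const_mul_atTop ht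
  · have : heatFun t =ᶠ[𝓝 r] fun x => Real.exp (-(t * (x⁻¹ - 1))) := by
      filter_upwards [lt_mem_nhds h] with x hx using heatFun_of_pos hx
    refine ContinuousAt.congr ?_ this.symm
    have := continuousAt_inv₀ h.ne'
    fun_prop

theorem heatFun_mul (s t r : ℝ) : heatFun s r * heatFun t r = heatFun (s + t) r := by
  rcases le_or_gt r 0 with h | h
  · simp [heatFun, h]
  · rw [heatFun_of_pos h, heatFun_of_pos h, heatFun_of_pos h, ← Real.exp_add]
    ring_nf

theorem heatFun_nonneg (t r : ℝ) : 0 ≤ heatFun t r := by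
  unfold heatFun; split_ifs <;> positivity

theorem heatFun_le_one {t r : ℝ} (ht : 0 ≤ t) (hr : r ≤ 1) : heatFun t r ≤ 1 := by
  unfold heatFun
  split_ifs with h
  · exact zero_le_one
  · have := (one_le_inv₀ (not_le.1 h)).2 hr
    rw [Real.exp_le_one_iff]
    nlinarith

/-- With `s = 1/r - 1`, `1 - exp (-t s) ≤ t s`, and the factor `r` absorbs `s` because `r s = 1 - r
≤ 1`. This is the scalar form of `‖(P_t - 1) R‖ ≤ t`. -/
theorem abs_heatFun_sub_one_mul_le {t r : ℝ} (ht : 0 ≤ t) (h0 : 0 ≤ r) (h1 : r ≤ 1) :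
    |(heatFun t r - 1) * r| ≤ t := by
  rcases h0.eq_or_lt with rfl | h
  · simpa
  · have h2 := heatFun_le_one ht h1
    have h3 : 1 - t * (r⁻¹ - 1) ≤ heatFun t r := by
      rw [heatFun_of_pos h]
      linarith [Real.add_one_le_exp (-(t * (r⁻¹ - 1)))]
    have h4 : (1 - t * (r⁻¹ - 1)) * r = r - t * (1 - r) := by field_simp
    have h5 := mul_le_mul_of_nonneg_right h3 h0
    rw [h4] at h5
    rw [abs_le]
    constructor <;> nlinarith

theorem exp_neg_le_one_sub_add_sq {x : ℝ} (hx : 0 ≤ x) : Real.exp (-x) ≤ 1 - x + x ^ 2 := by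
  rcases le_or_gt x 1 with h | h
  · have := Real.abs_exp_sub_one_sub_id_le (x := -x) (by rwa [abs_neg, abs_of_nonneg hx])
    have := (abs_le.1 this).2
    linarith [neg_sq x]
  · have : Real.exp (-x) ≤ 1 := Real.exp_le_one_iff.2 (by linarith)
    nlinarith

/-- The Taylor remainder of `exp (-t s)` lies between `0` and `(t s)²`, and two factors `r` absorb
`s²`. In operator form, the difference quotient on the range of `R²` converges with error at most
`t`. -/
theorem abs_heatFun_quotient_le {t r : ℝ} (ht : 0 < t) (h0 : 0 ≤ r) (h1 : r ≤ 1) :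
    |(t⁻¹ * ((heatFun t r - 1) * r) + (1 - r)) * r| ≤ t := by
  rcases h0.eq_or_lt with rfl | h
  · simpa using ht.le
  · set s := r⁻¹ - 1 with hs
    have hrs : r * s = 1 - r := by rw [hs]; field_simp
    have hs0 : 0 ≤ s := by have := (one_le_inv₀ h).2 h1; linarith
    have h2 : heatFun t r ≤ 1 - t * s + (t * s) ^ 2 := by
      rw [heatFun_of_pos h]; exact exp_neg_le_one_sub_add_sq (by positivity)
    have h3 : 1 - t * s ≤ heatFun t r := by
      rw [heatFun_of_pos h]
      linarith [Real.add_one_le_exp (-(t * (r⁻¹ - 1)))]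
    have key : (t⁻¹ * ((heatFun t r - 1) * r) + (1 - r)) * r
        = t⁻¹ * ((heatFun t r - (1 - t * s)) * r ^ 2) := by
      rw [← hrs]; field_simp; ring
    rw [key, abs_of_nonneg (mul_nonneg (by positivity) (mul_nonneg (by linarith) (by positivity))),
      inv_mul_le_iff₀ ht]
    calc (heatFun t r - (1 - t * s)) * r ^ 2 ≤ (t * s) ^ 2 * r ^ 2 := by gcongr; linarith
      _ = t * t * (r * s) ^ 2 := by ring
      _ ≤ t * t * 1 := by
        gcongr
        rw [hrs]
        nlinarith
      _ = t * t := mul_one _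

/-! ### The contraction semigroup generated by `-A` -/

section Semigroup

variable {H : Type*} [NormedAddCommGroup H] [InnerProductSpace ℂ H]

/-- Strong convergence of uniformly bounded operators can be checked on a dense set. -/
theorem tendsto_zero_of_dense {ι : Type*} {l : Filter ι} {T : ι → H →L[ℂ] H} {C : ℝ}
    (hT : ∀ᶠ i in l, ‖T i‖ ≤ C) {s : Set H} (hs : Dense s)
    (h : ∀ x ∈ s, Tendsto (fun i => T i x) l (𝓝 0)) (u : H) :
    Tendsto (fun i => T i u) l (𝓝 0) := by
  rw [Metric.tendsto_nhds]
  intro ε hε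
  -- `|C| + 1` replaces `C` to have a positive denominator.
  obtain ⟨x, hx, hux⟩ := Metric.dense_iff.1 hs u (ε / (2 * (|C| + 1))) (by positivity)
  filter_upwards [hT, Metric.tendsto_nhds.1 (h x hux) (ε / 2) (by positivity)] with i h1 h2
  rw [dist_zero_right] at h2 ⊢
  rw [Metric.mem_ball, dist_comm, dist_eq_norm] at hx
  calc ‖T i u‖ = ‖T i (u - x) + T i x‖ := by rw [map_sub, sub_add_cancel]
    _ ≤ ‖T i (u - x)‖ + ‖T i x‖ := norm_add_le _ _
    _ ≤ (|C| + 1) * ‖u - x‖ + ‖T i x‖ := by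
      gcongr
      exact (T i).le_of_opNorm_le (h1.trans ((le_abs_self C).trans (by linarith))) _
    _ < (|C| + 1) * (ε / (2 * (|C| + 1))) + ε / 2 := by gcongr
    _ = ε := by field_simp; ring

/-- Since `P_t u - P_s u = P_s (P_{t-s} u - u)` for `s ≤ t` and `P_s` is a contraction, continuity
at `0` from the right propagates to all times. -/
theorem IsContractionSemigroup.of_tendsto {P : ℝ≥0 → H →L[ℂ] H}
    (zero : P 0 = ContinuousLinearMap.id ℂ H) (add : ∀ s t, P (s + t) = (P s).comp (P t))
    (contraction : ∀ t u, ‖P t u‖ ≤ ‖u‖)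
    (hlim : ∀ u, Tendsto (fun t => P t u - u) (𝓝[>] 0) (𝓝 0)) : IsContractionSemigroup P := by
  refine ⟨zero, add, contraction, fun u => ?_⟩
  have hle : ∀ s t, s ≤ t → ‖P t u - P s u‖ ≤ ‖P (t - s) u - u‖ := by
    intro s t hst
    have : P t u = P s (P (t - s) u) := by
      rw [← ContinuousLinearMap.comp_apply, ← add, add_tsub_cancel_of_le hst]
    rw [this, ← map_sub]
    exact contraction _ _
  rw [Metric.continuous_iff]
  intro t ε hε
  have h1 := Metric.tendsto_nhds.1 (hlim u) ε hε
  rw [eventually_nhdsWithin_iff, Metric.eventually_nhds_iff] at h1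
  obtain ⟨δ, hδ, h2⟩ := h1
  have h3 : ∀ τ : ℝ≥0, (τ : ℝ) < δ → ‖P τ u - u‖ < ε := by
    intro τ hτ
    rcases eq_zero_or_pos τ with rfl | hpos
    · simpa [zero] using hε
    · have := h2 (y := τ) (by rw [NNReal.dist_eq]; simpa using hτ) hpos
      rwa [dist_zero_right] at this
  refine ⟨δ, hδ, fun s hs => ?_⟩
  rw [NNReal.dist_eq] at hs
  rw [dist_eq_norm]
  rcases le_total s t with h | h
  · rw [norm_sub_rev]
    refine (hle s t h).trans_lt (h3 _ ?_)
    rw [NNReal.coe_sub h]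
    rw [abs_sub_comm] at hs
    exact (le_abs_self _).trans_lt hs
  · refine (hle t s h).trans_lt (h3 _ ?_)
    rw [NNReal.coe_sub h]
    exact (le_abs_self _).trans_lt hs

variable [CompleteSpace H]

/-- `exp (-t (R⁻¹ - 1))` for a positive contraction `R`. -/
def heatSemigroup (R : H →L[ℂ] H) (t : ℝ≥0) : H →L[ℂ] H :=
  -- The case `t = 0` is separate because `heatFun 0` jumps at `0`, which may belong to the spectrum
  -- of `R`.
  if t = 0 then 1 else cfc (heatFun t) R

theorem heatSemigroup_of_pos (R : H →L[ℂ] H) {t : ℝ≥0} (ht : 0 < t) :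
    heatSemigroup R t = cfc (heatFun t) R := if_neg ht.ne'

theorem mem_Icc_of_mem_spectrum {R : H →L[ℂ] H} (h0 : 0 ≤ R) (h1 : ‖R‖ ≤ 1) {r : ℝ}
    (hr : r ∈ spectrum ℝ R) : r ∈ Set.Icc (0 : ℝ) 1 := by
  refine ⟨spectrum_nonneg_of_nonneg h0 hr, (le_abs_self r).trans ?_⟩
  -- The bound carries a factor `‖1‖`, which is only known to be at most `1` since `H` may be
  -- trivial.
  have h2 := spectrum.norm_le_norm_mul_of_mem hr
  rw [Real.norm_eq_abs] at h2
  refine h2.trans ?_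
  exact mul_le_one₀ h1 (norm_nonneg _) ContinuousLinearMap.norm_id_le

theorem heatSemigroup_sub_one_mul {R : H →L[ℂ] H} (h0 : 0 ≤ R) {t : ℝ≥0} (ht : 0 < t) :
    (heatSemigroup R t - 1) * R = cfc (fun r => (heatFun t r - 1) * r) R := by
  have hsa : IsSelfAdjoint R := IsSelfAdjoint.of_nonneg h0
  have hc := continuous_heatFun (NNReal.coe_pos.2 ht)
  rw [cfc_mul (fun r => heatFun t r - 1) (fun r => r) R (by fun_prop) (by fun_prop),
    cfc_sub (heatFun t) (fun _ => 1) R (by fun_prop) (by fun_prop), cfc_const_one ℝ R,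
    cfc_id' ℝ R, heatSemigroup_of_pos R ht]

theorem heatSemigroup_quotient {R : H →L[ℂ] H} (h0 : 0 ≤ R) {t : ℝ≥0} (ht : 0 < t) :
    ((t : ℝ)⁻¹ • ((heatSemigroup R t - 1) * R) + (1 - R)) * R
      = cfc (fun r => ((t : ℝ)⁻¹ * ((heatFun t r - 1) * r) + (1 - r)) * r) R := by
  have hsa : IsSelfAdjoint R := IsSelfAdjoint.of_nonneg h0
  have hc := continuous_heatFun (NNReal.coe_pos.2 ht)
  rw [cfc_mul (fun r => (t : ℝ)⁻¹ * ((heatFun t r - 1) * r) + (1 - r)) (fun r => r) R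
      (by fun_prop) (by fun_prop),
    cfc_add R (fun r => (t : ℝ)⁻¹ * ((heatFun t r - 1) * r)) (fun r => 1 - r)
      (by fun_prop) (by fun_prop),
    cfc_const_mul (t : ℝ)⁻¹ (fun r => (heatFun t r - 1) * r) R (by fun_prop),
    cfc_sub (fun _ => 1) (fun r => r) R (by fun_prop) (by fun_prop), cfc_const_one ℝ R,
    cfc_id' ℝ R, heatSemigroup_sub_one_mul h0 ht]

theorem commute_heatSemigroup {R : H →L[ℂ] H} (h0 : 0 ≤ R) (t : ℝ≥0) :
    Commute (heatSemigroup R t) R := by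
  have hsa : IsSelfAdjoint R := IsSelfAdjoint.of_nonneg h0
  unfold heatSemigroup
  split_ifs
  · exact Commute.one_left _
  · have := cfc_commute_cfc (heatFun t) (fun r => r) R
    rwa [cfc_id' ℝ R] at this

theorem norm_heatSemigroup_le {R : H →L[ℂ] H} (h0 : 0 ≤ R) (h1 : ‖R‖ ≤ 1) (t : ℝ≥0) :
    ‖heatSemigroup R t‖ ≤ 1 := by
  unfold heatSemigroup
  split_ifs
  · exact ContinuousLinearMap.norm_id_le
  · refine norm_cfc_le zero_le_one fun r hr => ?_
    rw [Real.norm_of_nonneg (heatFun_nonneg _ _)]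
    exact heatFun_le_one t.2 (mem_Icc_of_mem_spectrum h0 h1 hr).2

theorem heatSemigroup_add {R : H →L[ℂ] H} (s t : ℝ≥0) :
    heatSemigroup R (s + t) = heatSemigroup R s * heatSemigroup R t := by
  rcases eq_zero_or_pos s with rfl | hs
  · simp [heatSemigroup]
  rcases eq_zero_or_pos t with rfl | ht
  · simp [heatSemigroup]
  rw [heatSemigroup_of_pos R hs, heatSemigroup_of_pos R ht, heatSemigroup_of_pos R (add_pos hs ht),
    ← cfc_mul _ _ R (continuous_heatFun (NNReal.coe_pos.2 hs)).continuousOn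
      (continuous_heatFun (NNReal.coe_pos.2 ht)).continuousOn]
  congr 1
  ext r
  rw [heatFun_mul, NNReal.coe_add]

theorem tendsto_coe_nhdsGT_zero (C : ℝ) :
    Tendsto (fun t : ℝ≥0 => (t : ℝ) * C) (𝓝[>] 0) (𝓝 0) := by
  have : Tendsto (fun t : ℝ≥0 => (t : ℝ) * C) (𝓝 0) (𝓝 (((0 : ℝ≥0) : ℝ) * C)) :=
    (NNReal.continuous_coe.mul continuous_const).tendsto 0
  simp only [NNReal.coe_zero, zero_mul] at this
  exact this.mono_left nhdsWithin_le_nhds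

/-- On the dense range of `R`, `P_t - 1` is of size `O(t)`; the bound `‖P_t - 1‖ ≤ 2` extends the
convergence to every vector. -/
theorem isContractionSemigroup_heatSemigroup {R : H →L[ℂ] H} (h0 : 0 ≤ R) (h1 : ‖R‖ ≤ 1)
    (hd : DenseRange R) : IsContractionSemigroup (heatSemigroup R) := by
  refine .of_tendsto (if_pos rfl) heatSemigroup_add
    (fun t u => ?_) fun u => ?_
  · simpa using (heatSemigroup R t).le_of_opNorm_le (norm_heatSemigroup_le h0 h1 t) u
  · refine tendsto_zero_of_dense (T := fun t => heatSemigroup R t - 1) (C := 1 + 1)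
      (Eventually.of_forall fun t => (norm_sub_le _ _).trans
        (add_le_add (norm_heatSemigroup_le h0 h1 t) ContinuousLinearMap.norm_id_le)) hd ?_ u
    rintro _ ⟨z, rfl⟩
    refine squeeze_zero_norm' ?_ (tendsto_coe_nhdsGT_zero ‖z‖)
    filter_upwards [self_mem_nhdsWithin] with t ht
    change ‖((heatSemigroup R t - 1) * R) z‖ ≤ _
    refine ContinuousLinearMap.le_of_opNorm_le _ ?_ z
    rw [heatSemigroup_sub_one_mul h0 ht]
    refine norm_cfc_le t.2 fun r hr => ?_
    have := mem_Icc_of_mem_spectrum h0 h1 hr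
    exact abs_heatFun_sub_one_mul_le t.2 this.1 this.2

/-- If `R = (1 + A)⁻¹`, then `R z` is a general element of the domain and `R z - z = -A (R z)`. The
operators sending `z` to the difference between quotient and limit have norm at most `3`, and they
are `O(t)` on the range of `R`, so density applies again. -/
theorem tendsto_heatSemigroup_quotient {R : H →L[ℂ] H} (h0 : 0 ≤ R) (h1 : ‖R‖ ≤ 1)
    (hd : DenseRange R) (z : H) :
    Tendsto (fun t : ℝ≥0 => (((t : ℝ)⁻¹ : ℝ) : ℂ) • (heatSemigroup R t (R z) - R z))
      (𝓝[>] 0) (𝓝 (R z - z)) := by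
  have key : Tendsto (fun t : ℝ≥0 => ((t : ℝ)⁻¹ • ((heatSemigroup R t - 1) * R) + (1 - R)) z)
      (𝓝[>] 0) (𝓝 0) := by
    refine tendsto_zero_of_dense (C := 1 + (1 + 1)) ?_ hd ?_ z
    · filter_upwards [self_mem_nhdsWithin] with t ht
      have htr : (0 : ℝ) < t := NNReal.coe_pos.2 ht
      refine (norm_add_le _ _).trans (add_le_add ?_ ((norm_sub_le _ _).trans
        (add_le_add ContinuousLinearMap.norm_id_le h1)))
      rw [norm_smul, heatSemigroup_sub_one_mul h0 ht, Real.norm_of_nonneg (by positivity),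
        inv_mul_le_iff₀ htr, mul_one]
      refine norm_cfc_le t.2 fun r hr => ?_
      have := mem_Icc_of_mem_spectrum h0 h1 hr
      exact abs_heatFun_sub_one_mul_le t.2 this.1 this.2
    · rintro _ ⟨x, rfl⟩
      refine squeeze_zero_norm' ?_ (tendsto_coe_nhdsGT_zero ‖x‖)
      filter_upwards [self_mem_nhdsWithin] with t ht
      rw [← mul_apply_eq_comp]
      refine ContinuousLinearMap.le_of_opNorm_le _ ?_ x
      rw [heatSemigroup_quotient h0 ht]
      refine norm_cfc_le t.2 fun r hr => ?_
      have := mem_Icc_of_mem_spectrum h0 h1 hr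
      exact abs_heatFun_quotient_le (NNReal.coe_pos.2 ht) this.1 this.2
  have := key.sub_const (z - R z)
  rw [zero_sub, neg_sub] at this
  refine this.congr fun t => ?_
  rw [Complex.coe_smul]
  simp

/-- A positive self-adjoint operator `A` generates the contraction semigroup `exp (-t A)`. -/
theorem exists_contractionSemigroup {A : H →ₗ.[ℂ] H} (hA : IsSelfAdjoint A) (hpos : IsPos A) :
    ∃ P : ℝ≥0 → H →L[ℂ] H, IsContractionSemigroup P ∧ IsGenerator (-A) P := by
  obtain ⟨R, hR, h0, h1⟩ := exists_resolvent hA hpos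
  have hd : DenseRange R := by
    refine hA.dense_domain.mono ?_
    intro u hu
    exact ⟨_, (hR u _).1 (A.mem_graph ⟨u, hu⟩)⟩
  have hgraph : ∀ u w, (u, w) ∈ (-A).graph ↔ R (u - w) = u := by
    intro u w
    rw [sub_eq_add_neg, ← hR, LinearPMap.mem_graph_iff, LinearPMap.mem_graph_iff]
    constructor
    · rintro ⟨y, rfl, hw⟩
      have hw' : -(A y) = w := hw
      exact ⟨y, rfl, by rw [← hw', neg_neg]⟩
    · rintro ⟨y, rfl, hw⟩
      refine ⟨y, rfl, ?_⟩
      change -(A y) = w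
      rw [hw]; simp
  refine ⟨heatSemigroup R, isContractionSemigroup_heatSemigroup h0 h1 hd, fun u w => ?_⟩
  rw [hgraph]
  constructor
  -- Here `u = R (u - w)`, so the derivative at `0` is `u - (u - w) = w`.
  · intro h
    have := tendsto_heatSemigroup_quotient h0 h1 hd (u - w)
    rw [h] at this
    simpa using this
  -- Apply `R` to the convergent quotient. As `R` commutes with `P_t`, the result is the quotient at
  -- `R u`, whose limit is known; hence `R w = R u - u`.
  · intro h
    have h2 := (R.continuous.tendsto w).comp h
    have h3 := tendsto_heatSemigroup_quotient h0 h1 hd u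
    have : R w = R u - u := by
      refine tendsto_nhds_unique (h2.congr fun t => ?_) h3
      have hc := congrArg (fun T => T u) (commute_heatSemigroup h0 t)
      simp only [mul_apply_eq_comp] at hc
      simp only [Function.comp, map_smul, map_sub, hc]
    rw [map_sub, this, sub_sub_cancel]

end Semigroup

/-! ### The Friedrichs extension -/

section Friedrichs

variable {H : Type*} [NormedAddCommGroup H] [InnerProductSpace ℂ H]

/-- The domain of an operator, to be equipped with the energy norm. -/
def EnergySpace (T : H →ₗ.[ℂ] H) : Type _ := T.domain

instance (T : H →ₗ.[ℂ] H) : AddCommGroup (EnergySpace T) := inferInstanceAs (AddCommGroup T.domain)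

instance (T : H →ₗ.[ℂ] H) : Module ℂ (EnergySpace T) := inferInstanceAs (Module ℂ T.domain)

/-- The inclusion of the energy space. -/
def EnergySpace.incl (T : H →ₗ.[ℂ] H) : EnergySpace T →ₗ[ℂ] H := T.domain.subtype

/-- The operator on its energy space. -/
def EnergySpace.op (T : H →ₗ.[ℂ] H) : EnergySpace T →ₗ[ℂ] H := T.toFun

/-- The energy inner product `⟨u, w⟩ + ⟨u, T w⟩`. -/
@[reducible]
def energyCore {T : H →ₗ.[ℂ] H} (hs : IsSymm T) (hp : IsPos T) :
    InnerProductSpace.Core ℂ (EnergySpace T) where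
  inner u w := inner ℂ (EnergySpace.incl T u) (EnergySpace.incl T w)
    + inner ℂ (EnergySpace.incl T u) (EnergySpace.op T w)
  conj_inner_symm u w := by
    rw [map_add, inner_conj_symm, inner_conj_symm]
    congr 1
    exact hs.2 u w
  re_inner_nonneg u := by
    rw [map_add, inner_self_eq_norm_sq]
    exact add_nonneg (sq_nonneg _) (hp u).2
  add_left u v w := by
    rw [map_add, inner_add_left, inner_add_left]
    ring
  smul_left u w c := by
    rw [map_smul, inner_smul_left, inner_smul_left]
    ring
  definite u h := by
    have h1 := congrArg Complex.re h
    rw [Complex.add_re, ← RCLike.re_eq_complex_re, inner_self_eq_norm_sq, map_zero] at h1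
    have h2 : 0 ≤ RCLike.re (inner ℂ (EnergySpace.incl T u) (EnergySpace.op T u)) := (hp u).2
    have h3 : ‖EnergySpace.incl T u‖ ^ 2 = 0 := le_antisymm (by linarith) (sq_nonneg _)
    have h4 : EnergySpace.incl T u = 0 := by simpa using h3
    exact Subtype.ext h4

/-- The operator `S⁻¹ - 1`. -/
def invSubOne (S : H →L[ℂ] H) (hS : Function.Injective S) : H →ₗ.[ℂ] H where
  domain := LinearMap.range S.toLinearMap
  toFun := (LinearEquiv.ofInjective S.toLinearMap hS).symm.toLinearMap
    - (LinearMap.range S.toLinearMap).subtype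

theorem mem_graph_invSubOne {S : H →L[ℂ] H} (hS : Function.Injective S) (u w : H) :
    (u, w) ∈ (invSubOne S hS).graph ↔ S (u + w) = u := by
  rw [LinearPMap.mem_graph_iff]
  constructor
  · rintro ⟨⟨_, h, rfl⟩, rfl, hw⟩
    have e : (LinearEquiv.ofInjective S.toLinearMap hS).symm ⟨S h, h, rfl⟩ = h := by
      rw [LinearEquiv.symm_apply_eq]; rfl
    have hw' : (LinearEquiv.ofInjective S.toLinearMap hS).symm ⟨S h, h, rfl⟩ - S h = w := hw
    rw [e] at hw'
    change S (S h + w) = S h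
    rw [← hw', add_sub_cancel]
  · intro h
    refine ⟨⟨u, u + w, h⟩, rfl, ?_⟩
    have e : (LinearEquiv.ofInjective S.toLinearMap hS).symm ⟨u, u + w, h⟩ = u + w := by
      rw [LinearEquiv.symm_apply_eq]
      exact Subtype.ext h.symm
    change (LinearEquiv.ofInjective S.toLinearMap hS).symm ⟨u, u + w, h⟩ - u = w
    rw [e, add_sub_cancel_left]

/-- For `u = S h` the image is `h - S h`, so the form is `⟨h, S h⟩ - ‖S h‖²`. -/
theorem isPos_invSubOne {S : H →L[ℂ] H} (hS : Function.Injective S)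
    (hsym : ∀ h k, inner ℂ (S h) k = inner ℂ h (S k))
    (hle : ∀ h, ‖S h‖ ^ 2 ≤ (inner ℂ h (S h)).re) : IsPos (invSubOne S hS) := by
  intro u
  have h1 := (mem_graph_invSubOne hS _ _).1 ((invSubOne S hS).mem_graph u)
  set w := invSubOne S hS u
  set h := (u : H) + w
  have hw : w = h - S h := by rw [h1]; simp [h]
  have e : inner ℂ (u : H) w = inner ℂ h (S h) - ((‖S h‖ ^ 2 : ℝ) : ℂ) := by
    rw [← h1, hw, inner_sub_right, hsym h h, inner_self_eq_norm_sq_to_K]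
    push_cast
    rfl
  have him : (inner ℂ h (S h)).im = 0 := by
    have := inner_conj_symm (𝕜 := ℂ) h (S h)
    rw [hsym] at this
    exact Complex.conj_eq_iff_im.1 this
  rw [e, Complex.sub_im, Complex.sub_re, Complex.ofReal_im, Complex.ofReal_re, him]
  exact ⟨sub_zero 0, by linarith [hle h]⟩

variable [CompleteSpace H]

/-- Extend `J` to a contraction `K` on the completion of `D` and take `S = K K^*`. Then `⟨h, S h⟩ =
‖K^* h‖²`, which gives the inequality because `‖K‖ ≤ 1`, and injectivity because the dense range of
`K` makes `K^*` injective. Injectivity of `K` itself, that is, closability of the form, is not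
needed. The last clause says that `K^* h = u` can be tested on `D`. -/
theorem exists_energy_resolvent {D : Type*} [NormedAddCommGroup D] [InnerProductSpace ℂ D]
    (J : D →ₗ[ℂ] H) (hJ : ∀ u, ‖J u‖ ≤ ‖u‖) (hd : DenseRange J) :
    ∃ S : H →L[ℂ] H, (∀ h k, inner ℂ (S h) k = inner ℂ h (S k)) ∧ Function.Injective S ∧
      (∀ h, ‖S h‖ ^ 2 ≤ (inner ℂ h (S h)).re) ∧
      ∀ u h, (∀ w, inner ℂ w u = inner ℂ (J w) h) → S h = J u := by
  let i : D →L[ℂ] UniformSpace.Completion D := UniformSpace.Completion.toComplL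
  let J' : D →L[ℂ] H := J.mkContinuous 1 (by simpa using hJ)
  let K : UniformSpace.Completion D →L[ℂ] H := J'.extend i
  have hi : DenseRange i := UniformSpace.Completion.denseRange_coe
  have hK : ∀ u, K (i u) = J u := fun u =>
    J'.extend_eq hi (UniformSpace.Completion.isUniformInducing_coe D) u
  have hKn : ∀ z, ‖K z‖ ≤ ‖z‖ := by
    intro z
    refine hi.induction_on (p := fun z => ‖K z‖ ≤ ‖z‖) z
      (isClosed_le (by fun_prop) continuous_norm) fun u => ?_
    rw [hK]
    exact (hJ u).trans_eq (UniformSpace.Completion.norm_coe u).symm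
  have hKd : Dense (LinearMap.range K.toLinearMap : Set H) := by
    refine hd.mono ?_
    rintro _ ⟨u, rfl⟩
    exact ⟨i u, hK u⟩
  have hS : ∀ h k, inner ℂ h (K (K.adjoint k)) = inner ℂ (K.adjoint h) (K.adjoint k) :=
    fun h k => by rw [← ContinuousLinearMap.adjoint_inner_left]
  have hadj : Function.Injective K.adjoint := by
    rw [injective_iff_map_eq_zero]
    intro h hh
    refine hKd.eq_zero_of_inner_right ℂ ?_
    rintro _ ⟨z, rfl⟩
    change inner ℂ (K z) h = 0
    rw [← ContinuousLinearMap.adjoint_inner_right, hh, inner_zero_right]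
  refine ⟨K.comp K.adjoint, fun h k => ?_, ?_, fun h => ?_, fun u h hu => ?_⟩
  · rw [ContinuousLinearMap.comp_apply, ContinuousLinearMap.comp_apply, hS,
      ← ContinuousLinearMap.adjoint_inner_right]
  · rw [injective_iff_map_eq_zero]
    intro h hh
    have h1 := hS h h
    rw [ContinuousLinearMap.comp_apply] at hh
    rw [hh, inner_zero_right] at h1
    exact (injective_iff_map_eq_zero _).1 hadj h (inner_self_eq_zero.1 h1.symm)
  · rw [ContinuousLinearMap.comp_apply, hS, ← RCLike.re_eq_complex_re, inner_self_eq_norm_sq]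
    gcongr
    exact hKn _
  · rw [ContinuousLinearMap.comp_apply, ← hK]
    congr 1
    refine ext_inner_left ℂ fun z => ?_
    rw [ContinuousLinearMap.adjoint_inner_right]
    refine hi.induction_on (p := fun z => inner ℂ (K z) h = inner ℂ z (i u)) z
      (isClosed_eq (by fun_prop) (by fun_prop)) fun w => ?_
    rw [hK, ← hu]
    exact (UniformSpace.Completion.inner_coe w u).symm

/-- The graph consists of the pairs `(S h, h - S h)`. Testing `(u, w)` against all of them gives `⟨S
(u + w), h⟩ = ⟨u, h⟩`, which is membership in the same graph. -/
theorem isSelfAdjoint_invSubOne {S : H →L[ℂ] H} (hS : Function.Injective S)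
    (hsym : ∀ h k, inner ℂ (S h) k = inner ℂ h (S k)) : IsSelfAdjoint (invSubOne S hS) := by
  have hd : Dense ((invSubOne S hS).domain : Set H) := by
    rw [Submodule.dense_iff_topologicalClosure_eq_top,
      Submodule.topologicalClosure_eq_top_iff, Submodule.eq_bot_iff]
    intro h hh
    rw [Submodule.mem_orthogonal'] at hh
    refine (injective_iff_map_eq_zero S).1 hS h ?_
    rw [← inner_self_eq_zero (𝕜 := ℂ), hsym]
    exact hh _ ⟨_, rfl⟩
  rw [LinearPMap.isSelfAdjoint_def]
  refine LinearPMap.eq_of_eq_graph (Submodule.ext ?_)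
  rintro ⟨u, w⟩
  rw [mem_graph_adjoint_iff hd, mem_graph_invSubOne]
  constructor
  · intro hz
    refine ext_inner_right ℂ fun h => ?_
    have hg : (S h, h - S h) ∈ (invSubOne S hS).graph := by
      rw [mem_graph_invSubOne, add_sub_cancel]
    obtain ⟨z, h1, h2⟩ := (LinearPMap.mem_graph_iff _).1 hg
    have := hz z
    rw [h1, h2] at this
    dsimp only at this
    rw [hsym, inner_add_left, this, inner_sub_right]
    ring
  · intro h z
    have h1 := (mem_graph_invSubOne hS _ _).1 ((invSubOne S hS).mem_graph z)
    have h2 := hsym (u + w) (z + invSubOne S hS z)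
    rw [h, h1, inner_add_right, inner_add_left] at h2
    linear_combination -h2

/-- The Friedrichs extension of a positive symmetric operator. -/
theorem exists_selfAdjoint_extension {T : H →ₗ.[ℂ] H} (hs : IsSymm T) (hp : IsPos T) :
    ∃ A : H →ₗ.[ℂ] H, T ≤ A ∧ IsSelfAdjoint A ∧ IsPos A := by
  let := (energyCore hs hp).toNormedAddCommGroup
  let : InnerProductSpace ℂ (EnergySpace T) := InnerProductSpace.ofCore (energyCore hs hp).toCore
  have hinner : ∀ u w : EnergySpace T, inner ℂ u w
      = inner ℂ (EnergySpace.incl T u) (EnergySpace.incl T w)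
        + inner ℂ (EnergySpace.incl T u) (EnergySpace.op T w) := fun u w => rfl
  have hd : DenseRange (EnergySpace.incl T) := by
    refine hs.1.mono ?_
    intro u hu
    exact ⟨(⟨u, hu⟩ : T.domain), rfl⟩
  obtain ⟨S, hsym, hinj, hle, hS⟩ := exists_energy_resolvent (EnergySpace.incl T) (fun u => by
    refine le_of_sq_le_sq ?_ (norm_nonneg _)
    rw [← @inner_self_eq_norm_sq ℂ (EnergySpace T), hinner, map_add, inner_self_eq_norm_sq]
    have : 0 ≤ RCLike.re (inner ℂ (EnergySpace.incl T u) (EnergySpace.op T u)) := (hp u).2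
    linarith) hd
  refine ⟨invSubOne S hinj, ?_, isSelfAdjoint_invSubOne hinj hsym, isPos_invSubOne hinj hsym hle⟩
  refine LinearPMap.le_of_le_graph ?_
  rintro ⟨u, w⟩ h
  obtain ⟨y, rfl, rfl⟩ := (LinearPMap.mem_graph_iff T).1 h
  rw [mem_graph_invSubOne]
  -- With `h = y + T y`, the energy product `⟨w, y⟩ + ⟨w, T y⟩` equals `⟨w, h⟩`, so `S (y + T y) =
  -- y`.
  refine hS y _ fun w => (hinner w _).trans ?_
  exact (inner_add_right _ _ _).symm

end Friedrichs

/-! ### From mixed derivatives to joint derivatives -/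

section Mixed

variable {V W E : Type} [NormedAddCommGroup V] [NormedSpace ℝ V] [NormedAddCommGroup W]
  [NormedSpace ℝ W] [NormedAddCommGroup E] [NormedSpace ℝ E]

/-- The norm of the mixed derivative `D_x^k D_ξ^{k'} φ`. -/
def mixedNorm (k k' : ℕ) (φ : V → W → E) (x : V) (ξ : W) : ℝ :=
  ‖iteratedFDeriv ℝ k (fun z => iteratedFDeriv ℝ k' (φ z) ξ) x‖

/-- The partial derivative in the first variable. -/
def partialLeft (φ : V → W → E) (x : V) (ξ : W) : V →L[ℝ] E :=
  (fderiv ℝ (fun p : V × W => φ p.1 p.2) (x, ξ)).comp (.inl ℝ V W)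

/-- The partial derivative in the second variable. -/
def partialRight (φ : V → W → E) (x : V) (ξ : W) : W →L[ℝ] E :=
  (fderiv ℝ (fun p : V × W => φ p.1 p.2) (x, ξ)).comp (.inr ℝ V W)

variable {φ : V → W → E}

theorem hasFDerivAt_partialLeft (hφ : ContDiff ℝ ∞ (fun p : V × W => φ p.1 p.2)) (x : V) (ξ : W) :
    HasFDerivAt (fun z => φ z ξ) (partialLeft φ x ξ) x := by
  have h := (hφ.differentiable (by simp) (x, ξ)).hasFDerivAt
  exact HasFDerivAt.comp (g := fun p : V × W => φ p.1 p.2) (f := fun z => (z, ξ)) x h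
    (hasFDerivAt_prodMk_left x ξ)

theorem hasFDerivAt_partialRight (hφ : ContDiff ℝ ∞ (fun p : V × W => φ p.1 p.2)) (x : V) (ξ : W) :
    HasFDerivAt (φ x) (partialRight φ x ξ) ξ := by
  have h := (hφ.differentiable (by simp) (x, ξ)).hasFDerivAt
  exact h.comp ξ (hasFDerivAt_prodMk_right x ξ)

theorem contDiff_fderiv_infty {f : V → E} (hf : ContDiff ℝ ∞ f) : ContDiff ℝ ∞ (fderiv ℝ f) :=
  hf.fderiv_right (by exact_mod_cast le_top)

theorem contDiff_partialLeft (hφ : ContDiff ℝ ∞ (fun p : V × W => φ p.1 p.2)) :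
    ContDiff ℝ ∞ (fun p : V × W => partialLeft φ p.1 p.2) :=
  (contDiff_fderiv_infty hφ).clm_comp contDiff_const

theorem contDiff_partialRight (hφ : ContDiff ℝ ∞ (fun p : V × W => φ p.1 p.2)) :
    ContDiff ℝ ∞ (fun p : V × W => partialRight φ p.1 p.2) :=
  (contDiff_fderiv_infty hφ).clm_comp contDiff_const

/-- Symmetry of the second derivative, written with the isometry that exchanges the two arguments.
-/
theorem partialRight_partialLeft (hφ : ContDiff ℝ ∞ (fun p : V × W => φ p.1 p.2)) (x : V) (ξ : W) :
    partialRight (partialLeft φ) x ξ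
      = ContinuousLinearMap.flipₗᵢ ℝ V W E (partialLeft (partialRight φ) x ξ) := by
  set Φ : V × W → E := fun p => φ p.1 p.2 with hΦ
  have hd : DifferentiableAt ℝ (fderiv ℝ Φ) (x, ξ) :=
    (contDiff_fderiv_infty hφ).differentiable (by simp) _
  have hsymm : IsSymmSndFDerivAt ℝ Φ (x, ξ) :=
    hφ.contDiffAt.isSymmSndFDerivAt (by
      rw [minSmoothness_of_isRCLikeNormedField]
      change ((2 : ℕ∞) : WithTop ℕ∞) ≤ _
      exact_mod_cast le_top)
  have h1 : ∀ w v, partialRight (partialLeft φ) x ξ w v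
      = fderiv ℝ (fderiv ℝ Φ) (x, ξ) (0, w) (v, 0) := by
    intro w v
    have h : HasFDerivAt (fun p : V × W => partialLeft φ p.1 p.2) _ (x, ξ) :=
      hd.hasFDerivAt.clm_comp (hasFDerivAt_const (ContinuousLinearMap.inl ℝ V W) (x, ξ))
    unfold partialRight
    rw [h.fderiv]
    simp
  have h2 : ∀ v w, partialLeft (partialRight φ) x ξ v w
      = fderiv ℝ (fderiv ℝ Φ) (x, ξ) (v, 0) (0, w) := by
    intro v w
    have h : HasFDerivAt (fun p : V × W => partialRight φ p.1 p.2) _ (x, ξ) :=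
      hd.hasFDerivAt.clm_comp (hasFDerivAt_const (ContinuousLinearMap.inr ℝ V W) (x, ξ))
    unfold partialLeft
    rw [h.fderiv]
    simp
  ext w v
  rw [h1]
  change _ = partialLeft (partialRight φ) x ξ v w
  rw [h2]
  exact hsymm _ _

/-- The additional `ξ`-derivative is the innermost one, and currying it off is an isometry. -/
theorem mixedNorm_partialRight (hφ : ContDiff ℝ ∞ (fun p : V × W => φ p.1 p.2)) (k k' : ℕ)
    (x : V) (ξ : W) : mixedNorm k k' (partialRight φ) x ξ = mixedNorm k (k' + 1) φ x ξ := by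
  unfold mixedNorm
  have h1 : ∀ z, partialRight φ z = fderiv ℝ (φ z) := fun z =>
    funext fun η => (hasFDerivAt_partialRight hφ z η).fderiv.symm
  have h2 : (fun z => iteratedFDeriv ℝ (k' + 1) (φ z) ξ)
      = (continuousMultilinearCurryRightEquiv' ℝ k' W E).symm ∘
        fun z => iteratedFDeriv ℝ k' (partialRight φ z) ξ := by
    ext1 z
    rw [iteratedFDeriv_succ_eq_comp_right, Function.comp, Function.comp, h1]
  rw [h2]
  exact (LinearIsometryEquiv.norm_iteratedFDeriv_comp_left _ _ x k).symm

theorem mixedNorm_zero_right (k : ℕ) (x : V) (ξ : W) :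
    mixedNorm k 0 φ x ξ = ‖iteratedFDeriv ℝ k (fun z => φ z ξ) x‖ := by
  rw [mixedNorm, ← LinearIsometryEquiv.norm_iteratedFDeriv_comp_left
    (continuousMultilinearCurryFin0 ℝ W E).symm (fun z => φ z ξ)]
  simp only [iteratedFDeriv_zero_eq_comp]
  rfl

theorem contDiff_iteratedFDeriv_right (hφ : ContDiff ℝ ∞ (fun p : V × W => φ p.1 p.2)) (k' : ℕ)
    (ξ : W) : ContDiff ℝ ∞ (fun z => iteratedFDeriv ℝ k' (φ z) ξ) := by
  induction k' generalizing E with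
  | zero =>
    simp only [iteratedFDeriv_zero_eq_comp, Function.comp]
    exact (continuousMultilinearCurryFin0 ℝ W E).symm.contDiff.comp
      (hφ.comp (contDiff_id.prodMk contDiff_const))
  | succ n ih =>
    have h1 : ∀ z, partialRight φ z = fderiv ℝ (φ z) := fun z =>
      funext fun η => (hasFDerivAt_partialRight hφ z η).fderiv.symm
    simp only [iteratedFDeriv_succ_eq_comp_right, Function.comp]
    have hc : ContDiff ℝ ∞ (continuousMultilinearCurryRightEquiv' ℝ n W E).symm :=
      LinearIsometryEquiv.contDiff (E := W [×n]→L[ℝ] W →L[ℝ] E) (F := W [×n + 1]→L[ℝ] E) _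
    refine hc.comp ?_
    have := ih (contDiff_partialRight hφ)
    simpa only [h1] using this

theorem mixedNorm_comp_isometry_le {F : Type} [NormedAddCommGroup F] [NormedSpace ℝ F]
    (hφ : ContDiff ℝ ∞ (fun p : V × W => φ p.1 p.2))
    (g : E ≃ₗᵢ[ℝ] F) (k k' : ℕ) (x : V) (ξ : W) :
    mixedNorm k k' (fun z η => g (φ z η)) x ξ ≤ mixedNorm k k' φ x ξ := by
  unfold mixedNorm
  let L : E →L[ℝ] F := g.toLinearIsometry.toContinuousLinearMap
  let M := ContinuousLinearMap.compContinuousMultilinearMapL ℝ (fun _ : Fin k' => W) E F L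
  have hM : ‖M‖ ≤ 1 := by
    refine M.opNorm_le_bound zero_le_one fun q => ?_
    refine (L.norm_compContinuousMultilinearMap_le q).trans ?_
    gcongr
    exact g.toLinearIsometry.norm_toContinuousLinearMap_le
  have h : (fun z => iteratedFDeriv ℝ k' (fun η => g (φ z η)) ξ)
      = M ∘ fun z => iteratedFDeriv ℝ k' (φ z) ξ := by
    ext1 z
    have hz : ContDiff ℝ ∞ (φ z) := hφ.comp (contDiff_const.prodMk contDiff_id)
    exact L.iteratedFDeriv_comp_left (hz.contDiffAt (x := ξ)) (by exact_mod_cast le_top)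
  rw [h]
  refine (M.norm_iteratedFDeriv_comp_left (contDiff_iteratedFDeriv_right hφ k' ξ).contDiffAt
    (by exact_mod_cast le_top)).trans ?_
  exact mul_le_of_le_one_left (norm_nonneg _) hM

/-- The additional `x`-derivative is taken first and has to move past all the `ξ`-derivatives; each
induction step exchanges it with one of them. -/
theorem mixedNorm_partialLeft_le (hφ : ContDiff ℝ ∞ (fun p : V × W => φ p.1 p.2)) (k k' : ℕ)
    (x : V) (ξ : W) : mixedNorm k k' (partialLeft φ) x ξ ≤ mixedNorm (k + 1) k' φ x ξ := by
  induction k' generalizing E with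
  | zero =>
    rw [mixedNorm_zero_right, mixedNorm_zero_right, ← norm_iteratedFDeriv_fderiv]
    have : (fun z => partialLeft φ z ξ) = fderiv ℝ (fun z => φ z ξ) :=
      funext fun z => (hasFDerivAt_partialLeft hφ z ξ).fderiv.symm
    rw [this]
  | succ n ih =>
    rw [← mixedNorm_partialRight (contDiff_partialLeft hφ), ← mixedNorm_partialRight hφ]
    have : partialRight (partialLeft φ) = fun z η =>
        ContinuousLinearMap.flipₗᵢ ℝ V W E (partialLeft (partialRight φ) z η) :=
      funext fun z => funext fun η => partialRight_partialLeft hφ z η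
    rw [this]
    exact (mixedNorm_comp_isometry_le (contDiff_partialLeft (contDiff_partialRight hφ)) _ _ _ _
      _).trans (ih (contDiff_partialRight hφ))

/-- Bounds for all mixed derivatives give bounds for all joint derivatives. -/
theorem exists_bound_iteratedFDeriv_of_mixedNorm {wt : W → ℝ}
    (hφ : ContDiff ℝ ∞ (fun p : V × W => φ p.1 p.2))
    (hb : ∀ k k', ∃ C, ∀ x ξ, mixedNorm k k' φ x ξ ≤ C * wt ξ) (n : ℕ) :
    ∃ C, ∀ p : V × W, ‖iteratedFDeriv ℝ n (fun p : V × W => φ p.1 p.2) p‖ ≤ C * wt p.2 := by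
  induction n generalizing E with
  | zero =>
    obtain ⟨C, hC⟩ := hb 0 0
    refine ⟨C, fun p => ?_⟩
    have := hC p.1 p.2
    rw [mixedNorm_zero_right, norm_iteratedFDeriv_zero] at this
    rwa [norm_iteratedFDeriv_zero]
  | succ n ih =>
    obtain ⟨C₁, h₁⟩ := ih (contDiff_partialLeft hφ) fun k k' => by
      obtain ⟨C, hC⟩ := hb (k + 1) k'
      exact ⟨C, fun x ξ => (mixedNorm_partialLeft_le hφ k k' x ξ).trans (hC x ξ)⟩
    obtain ⟨C₂, h₂⟩ := ih (contDiff_partialRight hφ) fun k k' => by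
      obtain ⟨C, hC⟩ := hb k (k' + 1)
      exact ⟨C, fun x ξ => (mixedNorm_partialRight hφ k k' x ξ).trans_le (hC x ξ)⟩
    let L₁ := (ContinuousLinearMap.compL ℝ (V × W) V E).flip (.fst ℝ V W)
    let L₂ := (ContinuousLinearMap.compL ℝ (V × W) W E).flip (.snd ℝ V W)
    -- The total derivative is a sum of linear images of the two partial derivatives, to which the
    -- induction hypothesis applies with a new target space.
    have hd : fderiv ℝ (fun p : V × W => φ p.1 p.2)
        = (L₁ ∘ fun p => partialLeft φ p.1 p.2) + (L₂ ∘ fun p => partialRight φ p.1 p.2) := by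
      ext p v
      · simp [L₁, L₂, partialLeft, partialRight, Prod.mk_zero_zero]
      · simp [L₁, L₂, partialLeft, partialRight, Prod.mk_zero_zero]
    have hL₁ := L₁.contDiff.comp (contDiff_partialLeft hφ)
    have hL₂ := L₂.contDiff.comp (contDiff_partialRight hφ)
    refine ⟨‖L₁‖ * C₁ + ‖L₂‖ * C₂, fun p => ?_⟩
    rw [← norm_iteratedFDeriv_fderiv, hd, iteratedFDeriv_add_apply
      (hL₁.contDiffAt.of_le (by exact_mod_cast le_top))
      (hL₂.contDiffAt.of_le (by exact_mod_cast le_top))]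
    refine (norm_add_le _ _).trans ?_
    rw [add_mul, mul_assoc, mul_assoc]
    refine add_le_add ?_ ?_
    · refine (L₁.norm_iteratedFDeriv_comp_left (contDiff_partialLeft hφ).contDiffAt
        (by exact_mod_cast le_top)).trans ?_
      gcongr
      exact h₁ p
    · refine (L₂.norm_iteratedFDeriv_comp_left (contDiff_partialRight hφ).contDiffAt
        (by exact_mod_cast le_top)).trans ?_
      gcongr
      exact h₂ p

end Mixed

/-- The joint derivatives of a symbol have polynomial growth in `ξ`, of an order that does not
depend on the derivative. -/
theorem IsSymbol.exists_bound_iteratedFDeriv {d : ℕ} {m : ℝ} {a : Sp d → Sp d → ℂ}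
    (ha : IsSymbol m a) : ∃ N : ℕ, ∀ n, ∃ C, ∀ p : Sp d × Sp d,
      ‖iteratedFDeriv ℝ n (fun p : Sp d × Sp d => a p.1 p.2) p‖ ≤ C * (1 + ‖p.2‖) ^ N := by
  obtain ⟨N, hN⟩ := exists_nat_ge m
  refine ⟨N, fun n => exists_bound_iteratedFDeriv_of_mixedNorm
    (wt := fun ξ : Sp d => (1 + ‖ξ‖) ^ N) ha.smooth (fun k k' => ?_) n⟩
  obtain ⟨C, hC⟩ := ha.bound k k'
  refine ⟨|C|, fun x ξ => (hC x ξ).trans ?_⟩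
  have h2 : (1 + ‖ξ‖) ^ (m - (k' : ℝ)) ≤ (1 + ‖ξ‖) ^ N := by
    rw [← Real.rpow_natCast]
    apply Real.rpow_le_rpow_of_exponent_le (by linarith [norm_nonneg ξ])
    have : (0 : ℝ) ≤ k' := Nat.cast_nonneg k'
    linarith
  exact mul_le_mul (le_abs_self _) h2 (by positivity) (abs_nonneg _)

/-! ### Uniform families of Schwartz functions and rapidly decaying kernels -/

section UniformFamilies

section CompRight

variable {V W E : Type} [NormedAddCommGroup V] [NormedSpace ℝ V] [NormedAddCommGroup W]
  [NormedSpace ℝ W] [NormedAddCommGroup E] [NormedSpace ℝ E]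

theorem norm_iteratedFDeriv_comp_clm_le {f : W → E} (hf : ContDiff ℝ ∞ f) (L : V →L[ℝ] W)
    (hL : ‖L‖ ≤ 1) (n : ℕ) (x : V) :
    ‖iteratedFDeriv ℝ n (fun z => f (L z)) x‖ ≤ ‖iteratedFDeriv ℝ n f (L x)‖ := by
  have h := L.iteratedFDeriv_comp_right hf x (i := n) (by exact_mod_cast le_top)
  change ‖iteratedFDeriv ℝ n (f ∘ L) x‖ ≤ _
  rw [h]
  refine (ContinuousMultilinearMap.norm_compContinuousLinearMap_le _ _).trans ?_
  refine mul_le_of_le_one_right (norm_nonneg _) ?_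
  exact Finset.prod_le_one (fun _ _ => norm_nonneg _) fun _ _ => hL

theorem norm_iteratedFDeriv_slice_right_le {f : V × W → E} (hf : ContDiff ℝ ∞ f) (n : ℕ) (x : V)
    (ξ : W) : ‖iteratedFDeriv ℝ n (fun η => f (x, η)) ξ‖ ≤ ‖iteratedFDeriv ℝ n f (x, ξ)‖ := by
  have h := norm_iteratedFDeriv_comp_clm_le (f := fun p => f (p + (x, 0)))
    (hf.comp (contDiff_id.add contDiff_const)) (.inr ℝ V W)
    (ContinuousLinearMap.norm_inr_le_one ℝ V W) n ξ
  rw [iteratedFDeriv_comp_add_right] at h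
  simpa using h

theorem norm_iteratedFDeriv_slice_left_le {f : V × W → E} (hf : ContDiff ℝ ∞ f) (n : ℕ) (x : V)
    (ξ : W) : ‖iteratedFDeriv ℝ n (fun z => f (z, ξ)) x‖ ≤ ‖iteratedFDeriv ℝ n f (x, ξ)‖ := by
  have h := norm_iteratedFDeriv_comp_clm_le (f := fun p => f (p + (0, ξ)))
    (hf.comp (contDiff_id.add contDiff_const)) (.inl ℝ V W)
    (ContinuousLinearMap.norm_inl_le_one ℝ V W) n x
  rw [iteratedFDeriv_comp_add_right] at h
  simpa using h

end CompRight

variable {ι V E F G : Type} [NormedAddCommGroup V] [InnerProductSpace ℝ V]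
  [NormedAddCommGroup E] [NormedSpace ℂ E] [NormedAddCommGroup F] [NormedSpace ℂ F]
  [NormedAddCommGroup G] [NormedSpace ℂ G]

/-- A family of Schwartz functions whose seminorms are bounded by multiples of a weight `wt`. -/
structure UnifSchwartz (wt : ι → ℝ) (f : ι → V → E) : Prop where
  smooth : ∀ i, ContDiff ℝ ∞ (f i)
  bound : ∀ n j : ℕ, ∃ C : ℝ, ∀ i x, ‖x‖ ^ n * ‖iteratedFDeriv ℝ j (f i) x‖ ≤ C * wt i

/-- A family of smooth kernels `k(x, ξ)` that decay rapidly in `ξ`, with constants bounded by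
multiples of `wt x`. -/
structure RapidKernel (wt : V → ℝ) (k : ι → V × V → E) : Prop where
  smooth : ∀ i, ContDiff ℝ ∞ (k i)
  bound : ∀ n j : ℕ, ∃ C : ℝ, ∀ i (p : V × V),
    ‖p.2‖ ^ n * ‖iteratedFDeriv ℝ j (k i) p‖ ≤ C * wt p.1

/-- A smooth function `b(x, ξ)` whose derivatives grow at most like `wt x * (1 + |ξ|) ^ N`. -/
structure SlowGrowth {E : Type} [NormedAddCommGroup E] [NormedSpace ℝ E]
    (wt : V → ℝ) (b : V × V → E) : Prop where
  smooth : ContDiff ℝ ∞ b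
  bound : ∃ N : ℕ, ∀ j : ℕ, ∃ C : ℝ, ∀ p : V × V,
    ‖iteratedFDeriv ℝ j b p‖ ≤ C * (wt p.1 * (1 + ‖p.2‖) ^ N)

/-- Treating `x` as a further index makes the uniform Fourier estimates available for `ξ ↦ k(x, ξ)`.
-/
theorem RapidKernel.slices {wt : V → ℝ} {k : ι → V × V → E} (hk : RapidKernel wt k) :
    UnifSchwartz (fun q : ι × V => wt q.2) (fun q ξ => k q.1 (q.2, ξ)) where
  smooth q := (hk.smooth q.1).comp (contDiff_const.prodMk contDiff_id)
  bound n j := by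
    obtain ⟨C, hC⟩ := hk.bound n j
    refine ⟨C, fun q ξ => le_trans ?_ (hC q.1 (q.2, ξ))⟩
    gcongr
    exact norm_iteratedFDeriv_slice_right_le (hk.smooth q.1) j q.2 ξ

theorem UnifSchwartz.rapidKernel {f : ι → V → E} (hf : UnifSchwartz (fun _ => 1) f) :
    RapidKernel (fun _ => 1) (fun i (p : V × V) => f i p.2) where
  smooth i := (hf.smooth i).comp contDiff_snd
  bound n j := by
    obtain ⟨C, hC⟩ := hf.bound n j
    refine ⟨C, fun i p => le_trans ?_ (hC i p.2)⟩
    gcongr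
    exact norm_iteratedFDeriv_comp_clm_le (hf.smooth i) (.snd ℝ V V)
      (ContinuousLinearMap.norm_snd_le ℝ V V) j p

theorem RapidKernel.exists_bound {wt : V → ℝ} {k : ι → V × V → E} (hk : RapidKernel wt k)
    (n N j : ℕ) : ∃ C : ℝ, ∀ i (p : V × V),
      ‖p.2‖ ^ n * (1 + ‖p.2‖) ^ N * ‖iteratedFDeriv ℝ j (k i) p‖ ≤ C * wt p.1 := by
  obtain ⟨C₁, h₁⟩ := hk.bound n j
  obtain ⟨C₂, h₂⟩ := hk.bound (n + N) j
  refine ⟨2 ^ (N - 1) * (C₁ + C₂), fun i p => ?_⟩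
  have h := add_pow_le zero_le_one (norm_nonneg p.2) N
  calc ‖p.2‖ ^ n * (1 + ‖p.2‖) ^ N * ‖iteratedFDeriv ℝ j (k i) p‖
      ≤ ‖p.2‖ ^ n * (2 ^ (N - 1) * (1 ^ N + ‖p.2‖ ^ N)) * ‖iteratedFDeriv ℝ j (k i) p‖ := by
        gcongr
    _ = 2 ^ (N - 1) * (‖p.2‖ ^ n * ‖iteratedFDeriv ℝ j (k i) p‖
          + ‖p.2‖ ^ (n + N) * ‖iteratedFDeriv ℝ j (k i) p‖) := by rw [pow_add]; ring
    _ ≤ 2 ^ (N - 1) * (C₁ * wt p.1 + C₂ * wt p.1) := by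
        exact mul_le_mul_of_nonneg_left (add_le_add (h₁ i p) (h₂ i p)) (by positivity)
    _ = _ := by ring

/-- Leibniz rule; the factor `(1 + |ξ|) ^ N`, with `N` independent of the derivative, is absorbed by
the rapid decay of `k`. -/
theorem SlowGrowth.bilin {E : Type} [NormedAddCommGroup E] [NormedSpace ℝ E]
    {wt wt' : V → ℝ} (hwt : ∀ x, 0 ≤ wt x)
    {b : V × V → E} {k : ι → V × V → F} (hb : SlowGrowth wt b) (hk : RapidKernel wt' k)
    (B : E →L[ℝ] F →L[ℝ] G) :
    RapidKernel (fun x => wt x * wt' x) (fun i p => B (b p) (k i p)) where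
  smooth i := B.isBoundedBilinearMap.contDiff.comp (hb.smooth.prodMk (hk.smooth i))
  bound n j := by
    obtain ⟨N, hN⟩ := hb.bound
    choose C hC using hN
    choose D hD using hk.exists_bound n N
    refine ⟨‖B‖ * ∑ l ∈ Finset.range (j + 1), (j.choose l : ℝ) * |C l| * D (j - l), fun i p => ?_⟩
    have h := B.norm_iteratedFDeriv_le_of_bilinear hb.smooth (hk.smooth i) p (n := j)
      (by exact_mod_cast le_top)
    refine (mul_le_mul_of_nonneg_left h (by positivity)).trans ?_
    rw [mul_left_comm, mul_assoc, Finset.mul_sum, Finset.sum_mul]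
    refine mul_le_mul_of_nonneg_left (Finset.sum_le_sum fun l _ => ?_) B.opNorm_nonneg
    have h1 : ‖iteratedFDeriv ℝ l b p‖ ≤ |C l| * (wt p.1 * (1 + ‖p.2‖) ^ N) :=
      (hC l p).trans (mul_le_mul_of_nonneg_right (le_abs_self _)
        (mul_nonneg (hwt _) (by positivity)))
    calc ‖p.2‖ ^ n * ((j.choose l : ℝ) * ‖iteratedFDeriv ℝ l b p‖
          * ‖iteratedFDeriv ℝ (j - l) (k i) p‖)
        ≤ ‖p.2‖ ^ n * ((j.choose l : ℝ) * (|C l| * (wt p.1 * (1 + ‖p.2‖) ^ N))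
          * ‖iteratedFDeriv ℝ (j - l) (k i) p‖) := by gcongr
      _ = (j.choose l : ℝ) * |C l| * wt p.1 * (‖p.2‖ ^ n * (1 + ‖p.2‖) ^ N
          * ‖iteratedFDeriv ℝ (j - l) (k i) p‖) := by ring
      _ ≤ (j.choose l : ℝ) * |C l| * wt p.1 * (D (j - l) * wt' p.1) := by
          have := hwt p.1
          exact mul_le_mul_of_nonneg_left (hD _ i p) (by positivity)
      _ = _ := by ring

theorem RapidKernel.comp_left {wt : V → ℝ} {k : ι → V × V → E} (hk : RapidKernel wt k)
    (L : E →L[ℝ] F) : RapidKernel wt (fun i p => L (k i p)) where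
  smooth i := L.contDiff.comp (hk.smooth i)
  bound n j := by
    obtain ⟨C, hC⟩ := hk.bound n j
    refine ⟨‖L‖ * C, fun i p => ?_⟩
    have h := L.norm_iteratedFDeriv_comp_left ((hk.smooth i).contDiffAt (x := p)) (n := j)
      (by exact_mod_cast le_top)
    calc ‖p.2‖ ^ n * ‖iteratedFDeriv ℝ j (fun p => L (k i p)) p‖
        ≤ ‖p.2‖ ^ n * (‖L‖ * ‖iteratedFDeriv ℝ j (k i) p‖) := by gcongr; exact h
      _ = ‖L‖ * (‖p.2‖ ^ n * ‖iteratedFDeriv ℝ j (k i) p‖) := by ring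
      _ ≤ ‖L‖ * (C * wt p.1) :=
          mul_le_mul_of_nonneg_left (hC i p) (norm_nonneg _)
      _ = _ := by ring

theorem RapidKernel.add {wt : V → ℝ} {k k' : ι → V × V → E} (hk : RapidKernel wt k)
    (hk' : RapidKernel wt k') : RapidKernel wt (fun i p => k i p + k' i p) where
  smooth i := (hk.smooth i).add (hk'.smooth i)
  bound n j := by
    obtain ⟨C, hC⟩ := hk.bound n j
    obtain ⟨C', hC'⟩ := hk'.bound n j
    refine ⟨C + C', fun i p => ?_⟩
    have h : iteratedFDeriv ℝ j (fun p => k i p + k' i p) p = _ := iteratedFDeriv_add_apply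
      ((hk.smooth i).contDiffAt.of_le (by exact_mod_cast le_top))
      ((hk'.smooth i).contDiffAt.of_le (by exact_mod_cast le_top))
    rw [h, add_mul]
    refine (mul_le_mul_of_nonneg_left (norm_add_le _ _) (by positivity)).trans ?_
    rw [mul_add]
    exact add_le_add (hC i p) (hC' i p)

theorem RapidKernel.rapid_fderiv {wt : V → ℝ} {k : ι → V × V → E} (hk : RapidKernel wt k) :
    RapidKernel wt (fun i => fderiv ℝ (k i)) where
  smooth i := contDiff_fderiv_infty (hk.smooth i)
  bound n j := by
    obtain ⟨C, hC⟩ := hk.bound n (j + 1)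
    exact ⟨C, fun i p => by rw [norm_iteratedFDeriv_fderiv]; exact hC i p⟩

/-- This is the factor `ξ` produced by differentiating the phase. It is linear, so all its
derivatives are bounded. -/
theorem slowGrowth_innerSL : SlowGrowth (fun _ => 1) (fun p : V × V => innerSL ℝ p.2) := by
  let L : V × V →L[ℝ] V →L[ℝ] ℝ := (innerSL ℝ).comp (.snd ℝ V V)
  refine ⟨L.contDiff, 1, fun j => ?_⟩
  change ∃ C, ∀ p, ‖iteratedFDeriv ℝ j L p‖ ≤ _
  cases j with
  | zero =>
    refine ⟨1, fun p => ?_⟩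
    rw [norm_iteratedFDeriv_zero]
    change ‖innerSL ℝ p.2‖ ≤ _
    rw [innerSL_apply_norm, one_mul, one_mul, pow_one]
    linarith
  | succ j =>
    refine ⟨‖L‖, fun p => ?_⟩
    have h1 : fderiv ℝ L = fun _ => L := funext fun p => L.fderiv
    have h2 : ‖iteratedFDeriv ℝ (j + 1) L p‖ ≤ ‖L‖ := by
      rw [← norm_iteratedFDeriv_fderiv, h1]
      rcases eq_or_ne j 0 with rfl | hj
      · rw [norm_iteratedFDeriv_zero]
      · rw [iteratedFDeriv_const_of_ne hj]
        rw [Pi.zero_apply, norm_zero]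
        exact L.opNorm_nonneg
    refine h2.trans (le_mul_of_one_le_right L.opNorm_nonneg ?_)
    rw [one_mul, pow_one]
    linarith [norm_nonneg p.2]

theorem UnifSchwartz.conj {f : ι → V → ℂ} (hf : UnifSchwartz (fun _ => 1) f) :
    UnifSchwartz (fun _ => 1) (fun i x => (starRingEnd ℂ) (f i x)) where
  smooth i := Complex.conjCLE.contDiff.comp (hf.smooth i)
  bound n j := by
    obtain ⟨C, hC⟩ := hf.bound n j
    refine ⟨C, fun i x => ?_⟩
    have h := LinearIsometryEquiv.norm_iteratedFDeriv_comp_left Complex.conjLIE (f i) x j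
    change _ * ‖iteratedFDeriv ℝ j (Complex.conjLIE ∘ f i) x‖ ≤ _
    rw [h]
    exact hC i x

/-- A member of a uniform family as a Schwartz function. -/
def UnifSchwartz.toSchwartz {wt : ι → ℝ} {f : ι → V → E} (hf : UnifSchwartz wt f) (i : ι) :
    𝓢(V, E) where
  toFun := f i
  smooth' := hf.smooth i
  decay' n j := by
    obtain ⟨C, hC⟩ := hf.bound n j
    exact ⟨C * wt i, hC i⟩

theorem unifSchwartz_of_schwartz (u : 𝓢(V, E)) :
    UnifSchwartz (fun _ : Unit => 1) (fun _ => (u : V → E)) where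
  smooth _ := u.smooth'
  bound n j := by
    obtain ⟨C, hC⟩ := u.decay' n j
    exact ⟨C, fun _ x => by rw [mul_one]; exact hC x⟩

end UniformFamilies

/-! ### Oscillatory integrals -/

section Oscillatory

variable {ι V E : Type} [NormedAddCommGroup V] [InnerProductSpace ℝ V]
  [NormedAddCommGroup E] [NormedSpace ℂ E]

/-- The kernel of the derivative of an oscillatory integral. -/
def oscDeriv (k : V × V → E) (p : V × V) : V →L[ℝ] E :=
  (fderiv ℝ k p).comp (.inl ℝ V V)
    + ContinuousLinearMap.smulRightL ℝ V E (innerSL ℝ p.2) ((2 * Real.pi * Complex.I : ℂ) • k p)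

/-- The class of kernels is stable under differentiation of the integral, so estimates on all
derivatives follow by induction from the estimate on the integral itself. -/
theorem RapidKernel.rapid_oscDeriv {wt : V → ℝ} {k : ι → V × V → E} (hk : RapidKernel wt k) :
    RapidKernel wt (fun i => oscDeriv (k i)) := by
  refine RapidKernel.add (hk.rapid_fderiv.comp_left
    ((ContinuousLinearMap.compL ℝ V (V × V) E).flip (.inl ℝ V V))) ?_
  have h := slowGrowth_innerSL.bilin (fun _ => zero_le_one) (hk.comp_left
    ((2 * Real.pi * Complex.I : ℂ) • ContinuousLinearMap.id ℝ E))
    (ContinuousLinearMap.smulRightL ℝ V E)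
  simp only [one_mul] at h
  exact h

theorem hasFDerivAt_osc_integrand {k : V × V → E} (hk : ContDiff ℝ ∞ k) (x ξ : V) :
    HasFDerivAt (fun z => Real.fourierChar (inner ℝ ξ z) • k (z, ξ))
      (Real.fourierChar (inner ℝ ξ x) • oscDeriv k (x, ξ)) x := by
  have h1 : HasFDerivAt (fun z => k (z, ξ)) ((fderiv ℝ k (x, ξ)).comp (.inl ℝ V V)) x :=
    HasFDerivAt.comp (g := k) (f := fun z => (z, ξ)) x
      (hk.differentiable (by simp) (x, ξ)).hasFDerivAt (hasFDerivAt_prodMk_left x ξ)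
  have h2 : HasFDerivAt (fun z => (Real.fourierChar (inner ℝ ξ z) : ℂ)) _ x :=
    HasFDerivAt.comp (g := fun t : ℝ => (Real.fourierChar t : ℂ)) (f := fun z => inner ℝ ξ z) x
      (Real.hasDerivAt_fourierChar (inner ℝ ξ x)).hasFDerivAt (innerSL ℝ ξ).hasFDerivAt
  have h3 := h2.smul h1
  refine h3.congr_fderiv ?_
  ext v
  simp [oscDeriv, Circle.smul_def]
  rw [← Complex.coe_smul, smul_smul, smul_smul]
  congr 1
  ring

variable [FiniteDimensional ℝ V] [MeasurableSpace V] [BorelSpace V]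

/-- An integrable function that dominates families of Schwartz functions. -/
def decayWeight (x : V) : ℝ :=
  (1 + ‖x‖) ^ (-((volume : Measure V).integrablePower : ℝ))

theorem integrable_decayWeight : Integrable (decayWeight : V → ℝ) :=
  Measure.integrable_pow_neg_integrablePower volume

theorem decayWeight_nonneg (x : V) : 0 ≤ decayWeight x := by
  unfold decayWeight; positivity

theorem decayWeight_le_one (x : V) : decayWeight x ≤ 1 :=
  Real.rpow_le_one_of_one_le_of_nonpos (by linarith [norm_nonneg x]) (by simp)

theorem UnifSchwartz.exists_le_decayWeight {wt : ι → ℝ} {f : ι → V → E} (hf : UnifSchwartz wt f) :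
    ∃ C, ∀ i x, ‖f i x‖ ≤ C * wt i * decayWeight x := by
  obtain ⟨C₁, h₁⟩ := hf.bound 0 0
  obtain ⟨C₂, h₂⟩ := hf.bound (0 + (volume : Measure V).integrablePower) 0
  refine ⟨2 ^ (volume : Measure V).integrablePower * (C₁ + C₂), fun i x => ?_⟩
  have h₁' := h₁ i x
  have h₂' := h₂ i x
  rw [norm_iteratedFDeriv_zero] at h₁' h₂'
  rw [pow_zero, one_mul] at h₁'
  have := pow_mul_le_of_le_of_pow_mul_le (norm_nonneg x) (norm_nonneg _) h₁' h₂'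
  rw [pow_zero, one_mul] at this
  refine this.trans_eq ?_
  rw [decayWeight]
  ring

theorem UnifSchwartz.integrable {wt : ι → ℝ} {f : ι → V → E} (hf : UnifSchwartz wt f) (i : ι) :
    Integrable (f i) := by
  obtain ⟨C, hC⟩ := hf.exists_le_decayWeight
  exact (integrable_decayWeight.const_mul (C * wt i)).mono'
    (hf.smooth i).continuous.aestronglyMeasurable (ae_of_all _ (hC i))

theorem UnifSchwartz.integrable_pow {wt : ι → ℝ} {f : ι → V → E} (hf : UnifSchwartz wt f)
    (i : ι) (n j : ℕ) : Integrable (fun x => ‖x‖ ^ n * ‖iteratedFDeriv ℝ j (f i) x‖) := by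
  obtain ⟨C₁, h₁⟩ := hf.bound 0 j
  obtain ⟨C₂, h₂⟩ := hf.bound (n + (volume : Measure V).integrablePower) j
  simp only [pow_zero, one_mul] at h₁
  exact integrable_of_le_of_pow_mul_le (h₁ i) (h₂ i)
    ((hf.smooth i).continuous_iteratedFDeriv (by exact_mod_cast le_top)).aestronglyMeasurable

theorem UnifSchwartz.integral_pow_le {wt : ι → ℝ} {f : ι → V → E} (hf : UnifSchwartz wt f)
    (n j : ℕ) : ∃ C, ∀ i, ∫ x, ‖x‖ ^ n * ‖iteratedFDeriv ℝ j (f i) x‖ ≤ C * wt i := by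
  obtain ⟨C₁, h₁⟩ := hf.bound 0 j
  obtain ⟨C₂, h₂⟩ := hf.bound (n + (volume : Measure V).integrablePower) j
  simp only [pow_zero, one_mul] at h₁
  refine ⟨2 ^ (volume : Measure V).integrablePower *
    (∫ x : V, (1 + ‖x‖) ^ (-((volume : Measure V).integrablePower : ℝ))) * (C₁ + C₂), fun i => ?_⟩
  refine (integral_pow_mul_le_of_le_of_pow_mul_le (h₁ i) (h₂ i)).trans_eq ?_
  ring

theorem UnifSchwartz.fourier {wt : ι → ℝ} {f : ι → V → E} (hf : UnifSchwartz wt f) :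
    UnifSchwartz wt (fun i => 𝓕 (f i)) where
  smooth i := Real.contDiff_fourier (N := ⊤) fun n _ => by
    simpa only [norm_iteratedFDeriv_zero] using hf.integrable_pow i n 0
  bound n j := by
    choose C hC using hf.integral_pow_le
    refine ⟨(2 * Real.pi) ^ j * (2 * j + 2) ^ n * ∑ p ∈ Finset.range (j + 1) ×ˢ
      Finset.range (n + 1), C p.1 p.2, fun i w => ?_⟩
    refine (Real.pow_mul_norm_iteratedFDeriv_fourier_le (K := ⊤) (N := ⊤)
      (hf.smooth i) (fun p q _ _ => hf.integrable_pow i p q) le_top le_top w).trans ?_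
    rw [mul_assoc _ (Finset.sum _ _), Finset.sum_mul]
    exact mul_le_mul_of_nonneg_left (Finset.sum_le_sum fun p _ => hC p.1 p.2 i) (by positivity)

/-- The oscillatory integral `∫ e^{2πi⟨x, ξ⟩} k(x, ξ) dξ`. -/
def osc (k : V × V → E) (x : V) : E := 𝓕⁻ (fun ξ => k (x, ξ)) x

theorem osc_eq (k : V × V → E) (x : V) :
    osc k x = ∫ ξ, Real.fourierChar (inner ℝ ξ x) • k (x, ξ) := Real.fourierInv_eq _ _

/-- Differentiation under the integral sign; the continuous weight is bounded on a closed ball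
around `x`, which yields a dominating function. -/
theorem RapidKernel.hasFDerivAt_osc [CompleteSpace E] {wt : V → ℝ} (hwt : Continuous wt)
    {k : ι → V × V → E}
    (hk : RapidKernel wt k) (i : ι) (x : V) :
    HasFDerivAt (osc (k i)) (osc (oscDeriv (k i)) x) x := by
  obtain ⟨C, hC⟩ := hk.rapid_oscDeriv.slices.exists_le_decayWeight
  obtain ⟨M, hM⟩ := (isCompact_closedBall x 1).exists_bound_of_continuousOn
    (hwt.const_mul C).continuousOn
  have hcont : ∀ {F : Type} [NormedAddCommGroup F] [NormedSpace ℂ F] {h : V → F} (z : V),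
      Continuous h → Continuous fun ξ => Real.fourierChar (inner ℝ ξ z) • h ξ := by
    intro F _ _ h z hh
    fun_prop
  have hk1 : ∀ z, Integrable (fun ξ => k i (z, ξ)) := fun z => hk.slices.integrable (i, z)
  have key := hasFDerivAt_integral_of_dominated_of_fderiv_le (𝕜 := ℝ) (μ := (volume : Measure V))
    (F := fun z ξ => Real.fourierChar (inner ℝ ξ z) • k i (z, ξ))
    (F' := fun z ξ => Real.fourierChar (inner ℝ ξ z) • oscDeriv (k i) (z, ξ))
    (x₀ := x) (s := Metric.closedBall x 1) (bound := fun ξ => M * decayWeight ξ)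
    (Metric.closedBall_mem_nhds x one_pos)
    (Eventually.of_forall fun z =>
      (hcont z (hk.slices.smooth (i, z)).continuous).aestronglyMeasurable)
    ?_ (hcont x (hk.rapid_oscDeriv.slices.smooth (i, x)).continuous).aestronglyMeasurable
    (ae_of_all _ fun ξ z hz => ?_) (integrable_decayWeight.const_mul M)
    (ae_of_all _ fun ξ z _ => hasFDerivAt_osc_integrand (hk.smooth i) z ξ)
  · have e1 : osc (k i) = fun z => ∫ ξ, Real.fourierChar (inner ℝ ξ z) • k i (z, ξ) :=
      funext (osc_eq _)
    rw [e1, osc_eq]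
    exact key
  · refine (hk1 x).norm.mono' (hcont x (hk.slices.smooth (i, x)).continuous).aestronglyMeasurable
      (ae_of_all _ fun ξ => ?_)
    rw [Circle.norm_smul]
  · refine (Circle.norm_smul _ (oscDeriv (k i) (z, ξ))).trans_le ((hC (i, z) ξ).trans ?_)
    exact mul_le_mul_of_nonneg_right ((le_abs_self _).trans (hM z hz)) (decayWeight_nonneg ξ)

/-- The value at `x` is the Fourier transform of the slice `k(x, ·)` at `-x`. The decay of that
transform is uniform over slices up to the weight, so it may be used at this point depending on `x`.
-/
theorem RapidKernel.exists_norm_osc_le {wt : V → ℝ} {k : ι → V × V → E} (hk : RapidKernel wt k)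
    (n : ℕ) : ∃ C, ∀ i x, ‖x‖ ^ n * ‖osc (k i) x‖ ≤ C * wt x := by
  obtain ⟨C, hC⟩ := hk.slices.fourier.bound n 0
  refine ⟨C, fun i x => ?_⟩
  have := hC (i, x) (-x)
  rwa [norm_iteratedFDeriv_zero, norm_neg, ← Real.fourierInv_eq_fourier_neg] at this

/-- Oscillatory integrals of rapidly decaying kernels are rapidly decaying with all derivatives. -/
theorem RapidKernel.contDiff_and_bound_osc [CompleteSpace E] {wt : V → ℝ} (hwt : Continuous wt)
    {k : ι → V × V → E} (hk : RapidKernel wt k) (j : ℕ) :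
    (∀ i, ContDiff ℝ j (osc (k i))) ∧
    ∀ n, ∃ C, ∀ i x, ‖x‖ ^ n * ‖iteratedFDeriv ℝ j (osc (k i)) x‖ ≤ C * wt x := by
  induction j generalizing E with
  | zero =>
    refine ⟨fun i => contDiff_zero.2 (continuous_iff_continuousAt.2 fun x =>
      (hk.hasFDerivAt_osc hwt i x).continuousAt), fun n => ?_⟩
    simpa only [norm_iteratedFDeriv_zero] using hk.exists_norm_osc_le n
  | succ j ih =>
    obtain ⟨h1, h2⟩ := ih hk.rapid_oscDeriv
    have hd : ∀ i, fderiv ℝ (osc (k i)) = osc (oscDeriv (k i)) := fun i =>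
      funext fun x => (hk.hasFDerivAt_osc hwt i x).fderiv
    refine ⟨fun i => ?_, fun n => ?_⟩
    · push_cast
      rw [contDiff_succ_iff_fderiv]
      refine ⟨fun x => (hk.hasFDerivAt_osc hwt i x).differentiableAt, fun h => ?_, ?_⟩
      · exact absurd h (by simp)
      · rw [hd]; exact h1 i
    · obtain ⟨C, hC⟩ := h2 n
      refine ⟨C, fun i x => ?_⟩
      rw [← norm_iteratedFDeriv_fderiv, hd]
      exact hC i x

/-- Polynomial growth of the weight is harmless: `N` further powers of decay cancel it. -/
theorem RapidKernel.unifSchwartz_osc [CompleteSpace E] {N : ℕ} {k : ι → V × V → E}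
    (hk : RapidKernel (fun x => (1 + ‖x‖) ^ N) k) :
    UnifSchwartz (fun _ => 1) (fun i => osc (k i)) := by
  have hwt : Continuous fun x : V => (1 + ‖x‖) ^ N := by fun_prop
  refine ⟨fun i => contDiff_infty.2 fun j => (hk.contDiff_and_bound_osc hwt j).1 i, fun n j => ?_⟩
  obtain ⟨C₁, h₁⟩ := (hk.contDiff_and_bound_osc hwt j).2 n
  obtain ⟨C₂, h₂⟩ := (hk.contDiff_and_bound_osc hwt j).2 (n + N)
  -- `2 ^ N` comes from `1 + ‖x‖ ≤ 2` when `‖x‖ ≤ 1` and `1 + ‖x‖ ≤ 2 ‖x‖` otherwise.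
  refine ⟨(|C₁| + |C₂|) * 2 ^ N, fun i x => ?_⟩
  rw [mul_one]
  rcases le_total ‖x‖ 1 with h | h
  · refine (h₁ i x).trans (mul_le_mul ?_ ?_ (by positivity) (by positivity))
    · linarith [le_abs_self C₁, abs_nonneg C₂]
    · gcongr; linarith
  · refine le_of_mul_le_mul_right ?_ (pow_pos (zero_lt_one.trans_le h) N)
    calc ‖x‖ ^ n * ‖iteratedFDeriv ℝ j (osc (k i)) x‖ * ‖x‖ ^ N
        = ‖x‖ ^ (n + N) * ‖iteratedFDeriv ℝ j (osc (k i)) x‖ := by rw [pow_add]; ring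
      _ ≤ C₂ * (1 + ‖x‖) ^ N := h₂ i x
      _ ≤ (|C₁| + |C₂|) * (2 * ‖x‖) ^ N := by
        refine mul_le_mul ?_ ?_ (by positivity) (by positivity)
        · linarith [le_abs_self C₂, abs_nonneg C₁]
        · gcongr; linarith
      _ = _ := by rw [mul_pow]; ring

theorem continuous_fourier_param {X : Type} [TopologicalSpace X] [FirstCountableTopology X]
    {f : X → V → E} (hf : Continuous fun p : X × V => f p.1 p.2) {c : X → ℝ} (hc : Continuous c)
    (hb : ∀ x v, ‖f x v‖ ≤ c x * decayWeight v) : Continuous fun p : X × V => 𝓕 (f p.1) p.2 := by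
  simp only [Real.fourier_eq]
  rw [continuous_iff_continuousAt]
  intro p
  have hcont : Continuous fun q : (X × V) × V =>
      Real.fourierChar (-inner ℝ q.2 q.1.2) • f q.1.1 q.2 := by
    have : Continuous fun q : (X × V) × V => f q.1.1 q.2 :=
      hf.comp ((continuous_fst.comp continuous_fst).prodMk continuous_snd)
    fun_prop
  refine continuousAt_of_dominated (bound := fun v => (c p.1 + 1) * decayWeight v)
    (Eventually.of_forall fun q => ?_) ?_ (integrable_decayWeight.const_mul _)
    (ae_of_all _ fun v => ?_)
  · exact (hcont.comp (continuous_const.prodMk continuous_id)).aestronglyMeasurable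
  · have h1 : ∀ᶠ q : X × V in 𝓝 p, c q.1 < c p.1 + 1 :=
      (hc.comp continuous_fst).continuousAt.eventually_lt continuousAt_const (by simp)
    filter_upwards [h1] with q hq
    refine ae_of_all _ fun v => ?_
    rw [Circle.norm_smul]
    exact (hb q.1 v).trans (mul_le_mul_of_nonneg_right hq.le (decayWeight_nonneg v))
  · exact (hcont.comp (continuous_id.prodMk continuous_const)).continuousAt

theorem RapidKernel.continuous_osc [TopologicalSpace ι] [FirstCountableTopology ι]
    {wt : V → ℝ} (hwt : Continuous wt) {k : ι → V × V → E} (hk : RapidKernel wt k)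
    (hc : Continuous fun q : ι × V × V => k q.1 q.2) :
    Continuous fun p : ι × V => osc (k p.1) p.2 := by
  obtain ⟨C, hC⟩ := hk.slices.exists_le_decayWeight
  have h := continuous_fourier_param (X := ι × V) (f := fun q ξ => k q.1 (q.2, ξ))
    (hc.comp ((continuous_fst.comp continuous_fst).prodMk
      ((continuous_snd.comp continuous_fst).prodMk continuous_snd)))
    (c := fun q => C * wt q.2) (by fun_prop) hC
  simp only [osc, Real.fourierInv_eq_fourier_neg]
  exact h.comp (continuous_id.prodMk continuous_snd.neg)

theorem UnifSchwartz.continuous_fourier [TopologicalSpace ι] [FirstCountableTopology ι]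
    {f : ι → V → E} (hf : UnifSchwartz (fun _ => 1) f)
    (hc : Continuous fun q : ι × V => f q.1 q.2) :
    Continuous fun p : ι × V => 𝓕 (f p.1) p.2 := by
  obtain ⟨C, hC⟩ := hf.exists_le_decayWeight
  exact continuous_fourier_param hc (c := fun _ => C * 1) continuous_const hC

end Oscillatory

/-! ### The operator `L₀` and its formal adjoint on Schwartz functions -/

section FormalAdjoint

variable {ι : Type} {d : ℕ} {m : ℝ} {a : Sp d → Sp d → ℂ}

theorem IsSymbol.slowGrowth (ha : IsSymbol m a) :
    SlowGrowth (fun _ => 1) (fun p : Sp d × Sp d => a p.1 p.2) := by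
  obtain ⟨N, hN⟩ := ha.exists_bound_iteratedFDeriv
  refine ⟨ha.smooth, N, fun j => ?_⟩
  obtain ⟨C, hC⟩ := hN j
  exact ⟨C, fun p => by rw [one_mul]; exact hC p⟩

/-- In the dual integral `x` is integrated and `ξ` is the outer variable, so the growth of the
symbol goes entirely into the weight. -/
theorem IsSymbol.slowGrowth_swap (ha : IsSymbol m a) :
    ∃ N : ℕ, SlowGrowth (fun ξ => (1 + ‖ξ‖) ^ N) (fun p : Sp d × Sp d => a p.2 p.1) := by
  obtain ⟨N, hN⟩ := ha.exists_bound_iteratedFDeriv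
  refine ⟨N, ha.smooth.comp (contDiff_snd.prodMk contDiff_fst), 0, fun j => ?_⟩
  obtain ⟨C, hC⟩ := hN j
  refine ⟨C, fun p => ?_⟩
  rw [pow_zero, mul_one]
  let L : Sp d × Sp d →L[ℝ] Sp d × Sp d := (ContinuousLinearMap.snd ℝ _ _).prod (.fst ℝ _ _)
  have hL : ‖L‖ ≤ 1 := L.opNorm_le_bound zero_le_one fun p => by
    rw [one_mul]
    exact max_le (norm_snd_le p) (norm_fst_le p)
  exact (norm_iteratedFDeriv_comp_clm_le ha.smooth L hL j p).trans (hC (p.2, p.1))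

/-- The kernel of `L₀ u`. -/
def pdoKernel (a : Sp d → Sp d → ℂ) (u : Sp d → ℂ) (p : Sp d × Sp d) : ℂ := a p.1 p.2 * 𝓕 u p.2

theorem pdo_eq_osc (u : Sp d → ℂ) : pdo a u = osc (pdoKernel a u) :=
  funext fun x => pdo_eq_fourierInv u x

/-- The function `ξ ↦ ∫ e^{2πi⟨x, ξ⟩} a(x, ξ) conj (g x) dx`, whose Fourier transform is the
complex conjugate of `L₀^* g`. -/
def dualPdo (a : Sp d → Sp d → ℂ) (g : Sp d → ℂ) : Sp d → ℂ :=
  osc fun p => a p.2 p.1 * (starRingEnd ℂ) (g p.2)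

/-- The formal adjoint of `pdo a`. -/
def adjPdo (a : Sp d → Sp d → ℂ) (g : Sp d → ℂ) (x : Sp d) : ℂ :=
  (starRingEnd ℂ) (𝓕 (dualPdo a g) x)

variable {u g : ι → Sp d → ℂ}

theorem IsSymbol.rapidKernel_pdoKernel (ha : IsSymbol m a) (hu : UnifSchwartz (fun _ => 1) u) :
    RapidKernel (fun _ => 1) (fun i => pdoKernel a (u i)) := by
  have := ha.slowGrowth.bilin (fun _ => zero_le_one) hu.fourier.rapidKernel
    (ContinuousLinearMap.mul ℝ ℂ)
  simp only [one_mul] at this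
  exact this

theorem IsSymbol.rapidKernel_dual (ha : IsSymbol m a) (hg : UnifSchwartz (fun _ => 1) g) : ∃ N : ℕ,
    RapidKernel (fun ξ => (1 + ‖ξ‖) ^ N)
      (fun i (p : Sp d × Sp d) => a p.2 p.1 * (starRingEnd ℂ) (g i p.2)) := by
  obtain ⟨N, hN⟩ := ha.slowGrowth_swap
  have := hN.bilin (fun _ => by positivity) hg.conj.rapidKernel (ContinuousLinearMap.mul ℝ ℂ)
  simp only [mul_one] at this
  exact ⟨N, this⟩

theorem IsSymbol.unifSchwartz_pdo (ha : IsSymbol m a) (hu : UnifSchwartz (fun _ => 1) u) :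
    UnifSchwartz (fun _ => 1) (fun i => pdo a (u i)) := by
  simp only [pdo_eq_osc]
  refine RapidKernel.unifSchwartz_osc (N := 0) ?_
  simpa only [pow_zero] using ha.rapidKernel_pdoKernel hu

theorem IsSymbol.unifSchwartz_dualPdo (ha : IsSymbol m a) (hg : UnifSchwartz (fun _ => 1) g) :
    UnifSchwartz (fun _ => 1) (fun i => dualPdo a (g i)) := by
  obtain ⟨N, hN⟩ := ha.rapidKernel_dual hg
  exact hN.unifSchwartz_osc

theorem IsSymbol.unifSchwartz_adjPdo (ha : IsSymbol m a) (hg : UnifSchwartz (fun _ => 1) g) :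
    UnifSchwartz (fun _ => 1) (fun i => adjPdo a (g i)) :=
  (ha.unifSchwartz_dualPdo hg).fourier.conj

theorem IsSymbol.continuous_pdo (ha : IsSymbol m a) [TopologicalSpace ι] [FirstCountableTopology ι]
    (hu : UnifSchwartz (fun _ => 1) u) (hc : Continuous fun q : ι × Sp d => u q.1 q.2) :
    Continuous fun q : ι × Sp d => pdo a (u q.1) q.2 := by
  simp only [pdo_eq_osc]
  refine (ha.rapidKernel_pdoKernel hu).continuous_osc continuous_const ?_
  have h1 := hu.continuous_fourier hc
  have h2 := ha.smooth.continuous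
  have h3 : Continuous fun q : ι × Sp d × Sp d => a q.2.1 q.2.2 :=
    h2.comp (g := fun p : Sp d × Sp d => a p.1 p.2) continuous_snd
  have h4 : Continuous fun q : ι × Sp d × Sp d => 𝓕 (u q.1) q.2.2 :=
    h1.comp (g := fun p : ι × Sp d => 𝓕 (u p.1) p.2) (f := fun q : ι × Sp d × Sp d => (q.1, q.2.2))
      (by fun_prop)
  exact h3.mul h4

theorem IsSymbol.continuous_adjPdo (ha : IsSymbol m a)
    [TopologicalSpace ι] [FirstCountableTopology ι]
    (hg : UnifSchwartz (fun _ => 1) g) (hc : Continuous fun q : ι × Sp d => g q.1 q.2) :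
    Continuous fun q : ι × Sp d => adjPdo a (g q.1) q.2 := by
  refine Complex.continuous_conj.comp ((ha.unifSchwartz_dualPdo hg).continuous_fourier ?_)
  obtain ⟨N, hN⟩ := ha.rapidKernel_dual hg
  refine hN.continuous_osc (by fun_prop) ?_
  have h2 := ha.smooth.continuous
  exact (h2.comp ((continuous_snd.comp continuous_snd).prodMk
    (continuous_fst.comp continuous_snd))).mul (Complex.continuous_conj.comp
    (hc.comp (continuous_fst.prodMk (continuous_snd.comp continuous_snd))))

/-- Fubini turns the left side into `∫ φ̂ b` with `b = dualPdo a g`. As `b` is a Schwartz function,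
the Fourier transform can be moved onto it, and `b̂` is the conjugate of `adjPdo a g`. -/
theorem IsSymbol.integral_conj_mul_pdo (ha : IsSymbol m a) (g φ : 𝓢(Sp d, ℂ)) :
    ∫ x, (starRingEnd ℂ) (g x) * pdo a φ x = ∫ x, (starRingEnd ℂ) (adjPdo a g x) * φ x := by
  have hg := unifSchwartz_of_schwartz g
  have hφ := unifSchwartz_of_schwartz φ
  let b : 𝓢(Sp d, ℂ) := (ha.unifSchwartz_dualPdo hg).toSchwartz ()
  have hb : ∀ ξ, b ξ = ∫ x, Real.fourierChar (inner ℝ x ξ) • (a x ξ * (starRingEnd ℂ) (g x)) :=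
    fun ξ => osc_eq (fun p : Sp d × Sp d => a p.2 p.1 * (starRingEnd ℂ) (g p.2)) ξ
  have h1 : ∫ x, (starRingEnd ℂ) (adjPdo a g x) * φ x = ∫ ξ, 𝓕 φ ξ * b ξ := by
    rw [SchwartzMap.integral_fourier_mul_eq]
    congr 1
    ext x
    rw [adjPdo, Complex.conj_conj, mul_comm, SchwartzMap.fourier_coe]
    rfl
  obtain ⟨C, hC⟩ := (ha.rapidKernel_pdoKernel hφ).slices.exists_le_decayWeight
  have hint : Integrable (fun p : Sp d × Sp d => (starRingEnd ℂ) (g p.1) *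
      (Real.fourierChar (inner ℝ p.2 p.1) • (a p.1 p.2 * 𝓕 (φ : Sp d → ℂ) p.2)))
      (volume.prod volume) := by
    have h2 : Integrable (fun p : Sp d × Sp d => ‖g p.1‖ * (C * 1 * decayWeight p.2))
        (volume.prod volume) :=
      (hg.integrable ()).norm.mul_prod (integrable_decayWeight.const_mul (C * 1))
    refine h2.mono' ?_ (ae_of_all _ fun p => ?_)
    · have c1 := ha.smooth.continuous
      have c2 := (hφ.fourier.smooth ()).continuous
      have c3 := g.continuous
      have c4 : Continuous fun p : Sp d × Sp d => (starRingEnd ℂ) (g p.1) :=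
        Complex.continuous_conj.comp (c3.comp continuous_fst)
      have c5 : Continuous fun p : Sp d × Sp d => a p.1 p.2 * 𝓕 (φ : Sp d → ℂ) p.2 :=
        c1.mul (c2.comp continuous_snd)
      exact (c4.mul (by fun_prop)).aestronglyMeasurable
    · rw [norm_mul, RCLike.norm_conj, Circle.norm_smul]
      exact mul_le_mul_of_nonneg_left (hC ((), p.1) p.2) (norm_nonneg _)
  have h3 : ∀ x, (starRingEnd ℂ) (g x) * pdo a φ x = ∫ ξ, (starRingEnd ℂ) (g x) *
      (Real.fourierChar (inner ℝ ξ x) • (a x ξ * 𝓕 (φ : Sp d → ℂ) ξ)) := by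
    intro x
    rw [integral_const_mul, pdo_eq_osc, osc_eq]
    rfl
  rw [h1]
  simp only [h3]
  rw [integral_integral_swap hint]
  congr 1
  ext ξ
  rw [hb, ← integral_const_mul]
  congr 1
  ext x
  rw [SchwartzMap.fourier_coe, Circle.smul_def, Circle.smul_def, real_inner_comm]
  simp only [smul_eq_mul]
  ring

theorem UnifSchwartz.memLp {f : ι → Sp d → ℂ} (hf : UnifSchwartz (fun _ => 1) f) (i : ι) :
    MemLp (f i) 2 (volume : Measure (Sp d)) :=
  (hf.toSchwartz i).memLp 2 volume

end FormalAdjoint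

/-! ### The action of `L₀^* L₀` on Schwartz functions -/

section AdjointMulSelf

theorem adjointMulSelf_spec {H : Type*} [NormedAddCommGroup H] [InnerProductSpace ℂ H]
    [CompleteSpace H] {T : H →ₗ.[ℂ] H} (hT : Dense (T.domain : Set H)) (u : T.domain) {w : H}
    (hw : ∀ z : T.domain, inner ℂ w (z : H) = inner ℂ (T u) (T z)) :
    ∃ y : (adjointMulSelf T).domain, (y : H) = u ∧ adjointMulSelf T y = w := by
  have hmem : T u ∈ T.adjoint.domain := LinearPMap.mem_adjoint_domain_of_exists _ ⟨w, hw⟩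
  refine ⟨⟨u, ⟨⟨u, hmem, rfl⟩, u.2⟩⟩, rfl, ?_⟩
  exact LinearPMap.adjoint_apply_eq hT ⟨T u, hmem⟩ hw

variable {d : ℕ} {m : ℝ} {a : Sp d → Sp d → ℂ}

theorem opL0_apply (ha : IsSymbol m a) (φ : 𝓢(Sp d, ℂ)) :
    opL0 ha ⟨schwartzL2 d φ, φ, rfl⟩ = pdoL2 ha φ := by
  have : (LinearEquiv.ofInjective (schwartzL2 d) (schwartzL2_injective d)).symm
      ⟨schwartzL2 d φ, φ, rfl⟩ = φ := by
    rw [LinearEquiv.symm_apply_eq]; rfl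
  change pdoL2 ha ((LinearEquiv.ofInjective (schwartzL2 d) (schwartzL2_injective d)).symm
      ⟨schwartzL2 d φ, φ, rfl⟩) = _
  rw [this]

theorem dense_domain_opL0 (ha : IsSymbol m a) : Dense ((opL0 ha).domain : Set (L2 (Sp d))) := by
  have h := SchwartzMap.denseRange_toLpCLM (E := Sp d) (F := ℂ) (μ := volume) (p := 2)
    ENNReal.ofNat_ne_top
  exact h

theorem coeFn_schwartzL2 (φ : 𝓢(Sp d, ℂ)) : (schwartzL2 d φ : Sp d → ℂ) =ᵐ[volume] φ :=
  SchwartzMap.coeFn_toLp φ 2 volume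

/-- By the formal adjoint identity, `adjPdo a (pdo a φ)` represents `ψ ↦ ⟨L₀ φ, L₀ ψ⟩`, so `L₀ φ` is
in the domain of `L₀^*`. -/
theorem exists_opL_apply (ha : IsSymbol m a) (φ : 𝓢(Sp d, ℂ)) :
    ∃ y : (opL ha).domain, ((y : L2 (Sp d)) : Sp d → ℂ) =ᵐ[volume] φ ∧
      (opL ha y : Sp d → ℂ) =ᵐ[volume] adjPdo a (pdo a φ) := by
  have hg := ha.unifSchwartz_pdo (unifSchwartz_of_schwartz φ)
  have hG := ha.unifSchwartz_adjPdo hg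
  obtain ⟨y, hy1, hy2⟩ := adjointMulSelf_spec (dense_domain_opL0 ha) ⟨schwartzL2 d φ, φ, rfl⟩
    (w := (hG.memLp ()).toLp _) (by
      rintro ⟨_, ψ, rfl⟩
      rw [opL0_apply, opL0_apply, L2.inner_def, L2.inner_def]
      have key := ha.integral_conj_mul_pdo (hg.toSchwartz ()) ψ
      refine (integral_congr_ae ?_).trans (key.symm.trans (integral_congr_ae ?_))
      · filter_upwards [(hG.memLp ()).coeFn_toLp, coeFn_schwartzL2 ψ] with x h1 h2
        rw [h1, h2, RCLike.inner_apply, mul_comm]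
        rfl
      · filter_upwards [(ha.memLp_pdo φ).coeFn_toLp, (ha.memLp_pdo ψ).coeFn_toLp] with x h1 h2
        rw [RCLike.inner_apply, mul_comm]
        change _ = ((ha.memLp_pdo ψ).toLp (pdo a ψ) x) *
          (starRingEnd ℂ) ((ha.memLp_pdo φ).toLp (pdo a φ) x)
        rw [h1, h2]
        rfl)
  refine ⟨y, ?_, ?_⟩
  · rw [hy1]; exact coeFn_schwartzL2 φ
  · have : opL ha y = (hG.memLp ()).toLp _ := hy2
    rw [this]
    exact (hG.memLp ()).coeFn_toLp

end AdjointMulSelf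

/-! ### The shear -/

section Shear

variable {d : ℕ} {f : Sp d → ℝ}

/-- The homeomorphism `(x, y) ↦ (x, y + f x)`. -/
def shearHomeo (hf : Continuous f) : Sp d × ℝ ≃ₜ Sp d × ℝ where
  toFun p := (p.1, p.2 + f p.1)
  invFun p := (p.1, p.2 - f p.1)
  left_inv p := by simp
  right_inv p := by simp
  continuous_toFun := by fun_prop
  continuous_invFun := by fun_prop

theorem measurePreserving_shearHomeo (hf : Continuous f) : MeasurePreserving (shearHomeo hf) := by
  refine MeasurePreserving.skew_product (f := fun x : Sp d => x) (g := fun x y => y + f x)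
    (MeasurePreserving.id volume) ?_ (ae_of_all _ fun x => map_add_right_eq_self volume (f x))
  exact (by fun_prop : Continuous fun p : Sp d × ℝ => p.2 + f p.1).measurable

theorem measurePreserving_shearHomeo_symm (hf : Continuous f) :
    MeasurePreserving (shearHomeo hf).symm :=
  MeasurePreserving.symm (shearHomeo hf).toMeasurableEquiv (measurePreserving_shearHomeo hf)

theorem IsTest.shear (hf : ContDiff ℝ ∞ f) {v : Sp d × ℝ → ℂ} (hv : IsTest v) :
    IsTest (shear f v) := by
  refine ⟨hv.1.comp (contDiff_fst.prodMk (contDiff_snd.add (hf.comp contDiff_fst))), ?_⟩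
  exact hv.2.comp_homeomorph (shearHomeo hf.continuous)

end Shear

/-! ### The Itô transform on test functions -/

section Frozen

variable {d : ℕ} {m : ℝ} {a : Sp d → Sp d → ℂ} {f : Sp d → ℝ}

theorem IsTest.unifSchwartz {w : Sp d × ℝ → ℂ} (hw : IsTest w) :
    UnifSchwartz (fun _ : ℝ => 1) (fun y x => w (x, y)) where
  smooth y := hw.1.comp (contDiff_id.prodMk contDiff_const)
  bound n j := by
    have hc : Continuous fun p : Sp d × ℝ => ‖p.1‖ ^ n * ‖iteratedFDeriv ℝ j w p‖ := by
      have := hw.1.continuous_iteratedFDeriv (m := j) (by exact_mod_cast le_top)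
      fun_prop
    have hs : HasCompactSupport fun p : Sp d × ℝ => ‖p.1‖ ^ n * ‖iteratedFDeriv ℝ j w p‖ :=
      (hw.2.iteratedFDeriv j).norm.mul_left
    obtain ⟨C, hC⟩ := hs.exists_bound_of_continuous hc
    refine ⟨C, fun y x => ?_⟩
    rw [mul_one]
    refine le_trans ?_ ((le_abs_self _).trans (hC (x, y)))
    gcongr
    exact norm_iteratedFDeriv_slice_left_le hw.1 j x y

/-- `L w` with `y` frozen. -/
def frozenL (a : Sp d → Sp d → ℂ) (w : Sp d × ℝ → ℂ) (p : Sp d × ℝ) : ℂ :=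
  adjPdo a (pdo a fun x => w (x, p.2)) p.1

theorem pdo_zero : pdo a (fun _ => 0) = fun _ => 0 := by
  ext x
  simp [pdo, Real.fourier_eq]

theorem adjPdo_zero : adjPdo a (fun _ => 0) = fun _ => 0 := by
  have h : dualPdo a (fun _ => 0) = fun _ => 0 := by
    ext ξ
    simp [dualPdo, osc_eq]
  ext x
  simp [adjPdo, h, Real.fourier_eq]

theorem continuous_frozenL (ha : IsSymbol m a) {w : Sp d × ℝ → ℂ} (hw : IsTest w) :
    Continuous (frozenL a w) := by
  have hu := hw.unifSchwartz
  have h1 : Continuous fun q : ℝ × Sp d => w (q.2, q.1) := hw.1.continuous.comp continuous_swap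
  have h2 := ha.continuous_adjPdo (ha.unifSchwartz_pdo hu) (ha.continuous_pdo hu h1)
  exact h2.comp (f := fun p : Sp d × ℝ => (p.2, p.1)) continuous_swap

/-- Decay in `x` is uniform in `y`, and the function vanishes when `y` is outside the compact
projection of the support. -/
theorem memLp_frozenL (ha : IsSymbol m a) {w : Sp d × ℝ → ℂ} (hw : IsTest w) :
    MemLp (frozenL a w) 2 := by
  obtain ⟨C, hC⟩ := (ha.unifSchwartz_adjPdo
    (ha.unifSchwartz_pdo hw.unifSchwartz)).exists_le_decayWeight
  rw [memLp_two_iff_integrable_sq_norm (continuous_frozenL ha hw).aestronglyMeasurable]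
  let K : Set ℝ := Prod.snd '' tsupport w
  have hK : IsCompact K := hw.2.image continuous_snd
  have hint : Integrable (fun p : Sp d × ℝ => (C * 1) ^ 2 * decayWeight p.1 *
      K.indicator (fun _ => (1 : ℝ)) p.2) (volume.prod volume) :=
    (integrable_decayWeight.const_mul ((C * 1) ^ 2)).mul_prod
      ((integrable_indicator_iff hK.measurableSet).2 (integrableOn_const hK.measure_lt_top.ne))
  refine hint.mono' ((continuous_frozenL ha hw).norm.pow 2).aestronglyMeasurable
    (ae_of_all _ fun p => ?_)
  rw [Real.norm_of_nonneg (by positivity)]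
  by_cases hp : p.2 ∈ K
  · rw [Set.indicator_of_mem hp, mul_one]
    calc ‖frozenL a w p‖ ^ 2 ≤ (C * 1 * decayWeight p.1) ^ 2 := by
          gcongr
          exact hC p.2 p.1
      _ = (C * 1) ^ 2 * (decayWeight p.1 * decayWeight p.1) := by ring
      _ ≤ (C * 1) ^ 2 * (decayWeight p.1 * 1) := by
          have := decayWeight_nonneg p.1
          gcongr
          exact decayWeight_le_one _
      _ = _ := by ring
  · have hz : (fun x => w (x, p.2)) = fun _ => 0 := by
      ext x
      by_contra hx
      exact hp ⟨(x, p.2), subset_tsupport w hx, rfl⟩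
    rw [frozenL, hz, pdo_zero, adjPdo_zero, norm_zero, Set.indicator_of_notMem hp]
    simp

theorem isFrozenApply_frozenL (ha : IsSymbol m a) {w : Sp d × ℝ → ℂ} (hw : IsTest w) :
    IsFrozenApply (opL ha) w (frozenL a w) :=
  ⟨continuous_frozenL ha hw, fun y => exists_opL_apply ha (hw.unifSchwartz.toSchwartz y)⟩

/-- For each `y` the slice is determined almost everywhere, hence everywhere by continuity. -/
theorem IsFrozenApply.unique {T : L2 (Sp d) →ₗ.[ℂ] L2 (Sp d)} {w G G' : Sp d × ℝ → ℂ}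
    (h : IsFrozenApply T w G) (h' : IsFrozenApply T w G') : G = G' := by
  ext ⟨x, y⟩
  obtain ⟨u, hu, hT⟩ := h.2 y
  obtain ⟨u', hu', hT'⟩ := h'.2 y
  obtain rfl : u = u' := Subtype.ext (Lp.ext (hu.trans hu'.symm))
  have hc : ∀ {G : Sp d × ℝ → ℂ}, Continuous G → Continuous fun x => G (x, y) := fun hG => by
    fun_prop
  exact congrFun ((Continuous.ae_eq_iff_eq volume (hc h.1) (hc h'.1)).1 (hT.symm.trans hT')) x

/-- The Itô transform of `L` applied to `v`. -/
def itoFun (a : Sp d → Sp d → ℂ) (f : Sp d → ℝ) (v : Sp d × ℝ → ℂ) (p : Sp d × ℝ) : ℂ :=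
  frozenL a (shear f v) (p.1, p.2 - f p.1)

theorem isItoTransform_iff (ha : IsSymbol m a) (hf : ContDiff ℝ ∞ f) {v : Sp d × ℝ → ℂ}
    (hv : IsTest v) (F : Sp d × ℝ → ℂ) :
    IsItoTransform (opL ha) f v F ↔ F = itoFun a f v := by
  have h := isFrozenApply_frozenL ha (hv.shear hf)
  constructor
  · rintro ⟨G, hG, hF⟩
    ext ⟨x, y⟩
    rw [hF, hG.unique h, itoFun]
  · rintro rfl
    exact ⟨_, h, fun x y => rfl⟩

theorem memLp_itoFun (ha : IsSymbol m a) (hf : ContDiff ℝ ∞ f) {v : Sp d × ℝ → ℂ}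
    (hv : IsTest v) : MemLp (itoFun a f v) 2 :=
  (memLp_frozenL ha (hv.shear hf)).comp_measurePreserving
    (measurePreserving_shearHomeo_symm hf.continuous)

theorem IsTest.memLp {v : Sp d × ℝ → ℂ} (hv : IsTest v) : MemLp v 2 :=
  hv.1.continuous.memLp_of_hasCompactSupport hv.2

theorem itoFun_zero : itoFun a f (fun _ => 0) = fun _ => 0 := by
  ext p
  simp only [itoFun, frozenL, shear, pdo_zero, adjPdo_zero]

theorem mem_graph_itoL_iff (ha : IsSymbol m a) (hf : ContDiff ℝ ∞ f)
    (p : L2 (Sp d × ℝ) × L2 (Sp d × ℝ)) :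
    p ∈ (itoL ha f).graph ↔ ∃ v, IsTest v ∧ (p.1 : Sp d × ℝ → ℂ) =ᵐ[volume] v ∧
      (p.2 : Sp d × ℝ → ℂ) =ᵐ[volume] itoFun a f v := by
  have hmem : ∀ p, p ∈ itoGraph (opL ha) f ↔ ∃ v, IsTest v ∧
      (p.1 : Sp d × ℝ → ℂ) =ᵐ[volume] v ∧ (p.2 : Sp d × ℝ → ℂ) =ᵐ[volume] itoFun a f v := by
    intro p
    constructor
    · rintro ⟨v, F, hv, hF, h1, h2⟩
      rw [isItoTransform_iff ha hf hv] at hF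
      exact ⟨v, hv, h1, hF ▸ h2⟩
    · rintro ⟨v, hv, h1, h2⟩
      exact ⟨v, _, hv, (isItoTransform_iff ha hf hv _).2 rfl, h1, h2⟩
  rw [itoL, Submodule.toLinearPMap_graph_eq, hmem]
  -- The graph is single-valued: a continuous function that vanishes almost everywhere is zero, and
  -- so is its transform.
  intro q hq hq1
  obtain ⟨v, hv, h1, h2⟩ := (hmem q).1 hq
  rw [hq1] at h1
  have h3 : v =ᵐ[volume] fun _ => 0 := h1.symm.trans (Lp.coeFn_zero ℂ 2 volume)
  have h4 : v = fun _ => 0 :=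
    (Continuous.ae_eq_iff_eq volume hv.1.continuous continuous_const).1 h3
  rw [h4, itoFun_zero] at h2
  exact Lp.ext (h2.trans (Lp.coeFn_zero ℂ 2 volume).symm)

theorem exists_test_of_mem_domain (ha : IsSymbol m a) (hf : ContDiff ℝ ∞ f)
    (u : (itoL ha f).domain) : ∃ v, IsTest v ∧
      ((u : L2 (Sp d × ℝ)) : Sp d × ℝ → ℂ) =ᵐ[volume] v ∧
      (itoL ha f u : Sp d × ℝ → ℂ) =ᵐ[volume] itoFun a f v :=
  (mem_graph_itoL_iff ha hf _).1 ((itoL ha f).mem_graph u)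

theorem exists_mem_domain_of_test (ha : IsSymbol m a) (hf : ContDiff ℝ ∞ f) {v : Sp d × ℝ → ℂ}
    (hv : IsTest v) : ∃ u : (itoL ha f).domain,
      ((u : L2 (Sp d × ℝ)) : Sp d × ℝ → ℂ) =ᵐ[volume] v ∧
      (itoL ha f u : Sp d × ℝ → ℂ) =ᵐ[volume] itoFun a f v := by
  have h : (hv.memLp.toLp v, (memLp_itoFun ha hf hv).toLp _) ∈ (itoL ha f).graph :=
    (mem_graph_itoL_iff ha hf _).2 ⟨v, hv, hv.memLp.coeFn_toLp,
      (memLp_itoFun ha hf hv).coeFn_toLp⟩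
  obtain ⟨u, h1, h2⟩ := (LinearPMap.mem_graph_iff _).1 h
  dsimp only at h1 h2
  exact ⟨u, h1 ▸ hv.memLp.coeFn_toLp, h2 ▸ (memLp_itoFun ha hf hv).coeFn_toLp⟩

/-- The sesquilinear form `∫ ⟨L₀ v̄(·, y), L₀ w̄(·, y)⟩ dy`. -/
def energyForm (a : Sp d → Sp d → ℂ) (f : Sp d → ℝ) (v w : Sp d × ℝ → ℂ) : ℂ :=
  ∫ y : ℝ, ∫ x : Sp d, (starRingEnd ℂ) (pdo a (fun z => shear f v (z, y)) x) *
    pdo a (fun z => shear f w (z, y)) x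

/-- The shear removes `f` from the outer variables, Fubini puts the `y`-integral outside, and the
formal adjoint identity applies for each `y`. -/
theorem integral_conj_itoFun_mul (ha : IsSymbol m a) (hf : ContDiff ℝ ∞ f)
    {v w : Sp d × ℝ → ℂ} (hv : IsTest v) (hw : IsTest w) :
    ∫ p, (starRingEnd ℂ) (itoFun a f v p) * w p = energyForm a f v w := by
  have hv' := hv.shear hf
  have hw' := hw.shear hf
  rw [← (measurePreserving_shearHomeo hf.continuous).integral_comp
    (shearHomeo hf.continuous).measurableEmbedding]
  have h1 : ∀ p, (starRingEnd ℂ) (itoFun a f v (shearHomeo hf.continuous p)) *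
      w (shearHomeo hf.continuous p)
        = (starRingEnd ℂ) (frozenL a (shear f v) p) * shear f w p := by
    intro p
    have : (shearHomeo hf.continuous).symm (shearHomeo hf.continuous p) = p :=
      (shearHomeo hf.continuous).symm_apply_apply p
    have h2 : itoFun a f v (shearHomeo hf.continuous p) = frozenL a (shear f v)
        ((shearHomeo hf.continuous).symm (shearHomeo hf.continuous p)) := rfl
    rw [h2, this]
    rfl
  simp only [h1]
  -- `frozenL` need not have compact support in `x`, but the factor `shear f w` has.
  have hint : Integrable (fun p => (starRingEnd ℂ) (frozenL a (shear f v) p) * shear f w p)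
      ((volume : Measure (Sp d)).prod (volume : Measure ℝ)) :=
    ((Complex.continuous_conj.comp (continuous_frozenL ha hv')).mul
      hw'.1.continuous).integrable_of_hasCompactSupport hw'.2.mul_left
  rw [Measure.volume_eq_prod, integral_prod_symm _ hint, energyForm]
  congr 1
  ext y
  exact (ha.integral_conj_mul_pdo ((ha.unifSchwartz_pdo hv'.unifSchwartz).toSchwartz y)
    (hw'.unifSchwartz.toSchwartz y)).symm

theorem conj_energyForm (v w : Sp d × ℝ → ℂ) :
    (starRingEnd ℂ) (energyForm a f v w) = energyForm a f w v := by
  rw [energyForm, ← integral_conj, energyForm]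
  congr 1
  ext y
  rw [← integral_conj]
  congr 1
  ext x
  rw [map_mul, Complex.conj_conj, mul_comm]

theorem inner_itoL_left (ha : IsSymbol m a) (hf : ContDiff ℝ ∞ f) {u z : (itoL ha f).domain}
    {v w : Sp d × ℝ → ℂ} (hv : IsTest v) (hw : IsTest w)
    (hu : (itoL ha f u : Sp d × ℝ → ℂ) =ᵐ[volume] itoFun a f v)
    (hz : ((z : L2 (Sp d × ℝ)) : Sp d × ℝ → ℂ) =ᵐ[volume] w) :
    inner ℂ (itoL ha f u) (z : L2 (Sp d × ℝ)) = energyForm a f v w := by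
  rw [L2.inner_def, ← integral_conj_itoFun_mul ha hf hv hw]
  refine integral_congr_ae ?_
  filter_upwards [hu, hz] with p h1 h2
  rw [h1, h2, RCLike.inner_apply, mul_comm]

theorem isSymm_itoL (ha : IsSymbol m a) (hf : ContDiff ℝ ∞ f) : IsSymm (itoL ha f) := by
  refine ⟨?_, fun u z => ?_⟩
  · have h := Lp.dense_hasCompactSupport_contDiff (F := ℂ) (p := 2) ENNReal.ofNat_ne_top
      (μ := (volume : Measure (Sp d × ℝ)))
    refine h.mono ?_
    rintro q ⟨v, hq, hc, hs⟩
    obtain ⟨u, hu, -⟩ := exists_mem_domain_of_test ha hf (v := v) ⟨hs, hc⟩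
    have : q = u := Lp.ext (hq.trans hu.symm)
    rw [this]
    exact u.2
  · obtain ⟨v, hv, h1, h2⟩ := exists_test_of_mem_domain ha hf u
    obtain ⟨w, hw, h3, h4⟩ := exists_test_of_mem_domain ha hf z
    rw [inner_itoL_left ha hf hv hw h2 h3, ← inner_conj_symm (u : L2 (Sp d × ℝ)),
      inner_itoL_left ha hf hw hv h4 h1, conj_energyForm]

theorem isPos_itoL (ha : IsSymbol m a) (hf : ContDiff ℝ ∞ f) : IsPos (itoL ha f) := by
  intro u
  obtain ⟨v, hv, h1, h2⟩ := exists_test_of_mem_domain ha hf u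
  have h3 : inner ℂ (u : L2 (Sp d × ℝ)) (itoL ha f u) = energyForm a f v v := by
    rw [← (isSymm_itoL ha hf).2, inner_itoL_left ha hf hv hv h2 h1]
  have h4 : energyForm a f v v
      = ((∫ y : ℝ, ∫ x : Sp d, ‖pdo a (fun z => shear f v (z, y)) x‖ ^ 2 : ℝ) : ℂ) := by
    rw [energyForm, ← integral_complex_ofReal]
    congr 1
    ext y
    rw [← integral_complex_ofReal]
    congr 1
    ext x
    rw [Complex.conj_mul', Complex.ofReal_pow]
  rw [h3, h4, Complex.ofReal_im, Complex.ofReal_re]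
  exact ⟨rfl, integral_nonneg fun y => integral_nonneg fun x => by positivity⟩

end Frozen

end ItoTransform
end

theorem theorem1 {d : ℕ} {m : ℝ} {a : ItoTransform.Sp d → ItoTransform.Sp d → ℂ}
    (ha : ItoTransform.IsSymbol m a) (hell : ItoTransform.IsElliptic m a)
    {f : ItoTransform.Sp d → ℝ} (hf : ContDiff ℝ ∞ f) (hfc : HasCompactSupport f) :
    -- every smooth compactly supported `v` has a unique Itô transform, it is square integrable,
    -- and these functions `v` form the domain of `L̂`
    (∀ v : ItoTransform.Sp d × ℝ → ℂ, ItoTransform.IsTest v →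
      ∃ F : ItoTransform.Sp d × ℝ → ℂ,
        ItoTransform.IsItoTransform (ItoTransform.opL ha) f v F ∧
        (∀ F', ItoTransform.IsItoTransform (ItoTransform.opL ha) f v F' → F' = F) ∧
        ∃ u : (ItoTransform.itoL ha f).domain,
          ((u : ItoTransform.L2 (ItoTransform.Sp d × ℝ)) : ItoTransform.Sp d × ℝ → ℂ)
            =ᵐ[volume] v ∧
          (ItoTransform.itoL ha f u : ItoTransform.Sp d × ℝ → ℂ) =ᵐ[volume] F) ∧
    (∀ u ∈ (ItoTransform.itoL ha f).domain, ∃ v : ItoTransform.Sp d × ℝ → ℂ,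
      ItoTransform.IsTest v ∧ (u : ItoTransform.Sp d × ℝ → ℂ) =ᵐ[volume] v) ∧
    -- `L̂` is positive and symmetric
    ItoTransform.IsSymm (ItoTransform.itoL ha f) ∧
    ItoTransform.IsPos (ItoTransform.itoL ha f) ∧
    -- `L̂` has a (positive) self-adjoint extension
    (∃ A : ItoTransform.L2 (ItoTransform.Sp d × ℝ) →ₗ.[ℂ] ItoTransform.L2 (ItoTransform.Sp d × ℝ),
      ItoTransform.itoL ha f ≤ A ∧ IsSelfAdjoint A ∧ ItoTransform.IsPos A) ∧
    -- each such extension `A` generates a contraction semigroup `P̂_t = e^{-tA}`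
    (∀ A : ItoTransform.L2 (ItoTransform.Sp d × ℝ) →ₗ.[ℂ] ItoTransform.L2 (ItoTransform.Sp d × ℝ),
      ItoTransform.itoL ha f ≤ A → IsSelfAdjoint A → ItoTransform.IsPos A →
      ∃ P : ℝ≥0 → ItoTransform.L2 (ItoTransform.Sp d × ℝ) →L[ℂ]
          ItoTransform.L2 (ItoTransform.Sp d × ℝ),
        ItoTransform.IsContractionSemigroup P ∧ ItoTransform.IsGenerator (-A) P) := by
  refine ⟨fun v hv => ⟨ItoTransform.itoFun a f v,
      (ItoTransform.isItoTransform_iff ha hf hv _).2 rfl,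
      fun F' hF' => (ItoTransform.isItoTransform_iff ha hf hv F').1 hF',
      ItoTransform.exists_mem_domain_of_test ha hf hv⟩,
    fun u hu => ?_, ItoTransform.isSymm_itoL ha hf, ItoTransform.isPos_itoL ha hf,
    ItoTransform.exists_selfAdjoint_extension (ItoTransform.isSymm_itoL ha hf)
      (ItoTransform.isPos_itoL ha hf),
    fun A _ hA hpos => ItoTransform.exists_contractionSemigroup hA hpos⟩
  obtain ⟨v, hv, h, -⟩ := ItoTransform.exists_test_of_mem_domain ha hf ⟨u, hu⟩
  exact ⟨v, hv, h⟩
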